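/- Let $\sigma\in(0,1)$ and $u(q)=q^\sigma/\sigma$ for $q\ge 0$. A cost function is a (weakly) increasing, (weakly) convex function $c:\mathbb R_+\to\mathbb R_+$ with $c(0)=0$ and $c\not\equiv 0$; let $\mathcal C_{cx}$ be the set of cost functions. A mechanism is a function $t:\mathbb R_+\to\mathbb R$ with $t(0)=0$ such that, for every $c\in\mathcal C_{cx}$, the set $\arg\max_{q\ge 0}\{t(q)-c(q)\}$ has a smallest element, denoted $q(c,t)$; let $T$ be the set of mechanisms. Put $U(c,t)=u(q(c,t))-t(q(c,t))$ and $W(c)=\max_{q\ge 0}\{u(q)-c(q)\}$. Let $\Delta\mathcal C_{cx}$ be the set of probability distributions $G$ on $\mathcal C_{cx}$ with $\int W\,dG<\infty$ and $\Delta T$ the set of probability distributions on $T$; here $\mathcal C_{cx}$ carries the coarsest $\sigma$-algebra making $W$ and all $U(\cdot,t)$ measurable, and $T$ the coarsest one making $t\mapsto\int U(c,t)\,dG(c)$ measurable for all $G\in\Delta\mathcal C_{cx}$ (integrals take values in $[-\infty,\infty)$). Let $$\underline B(\sigma)=\sup_{F\in\Delta T}\ \inf_{c\in\mathcal C_{cx}}\frac{\int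 U(c,t)\,dF(t)}{W(c)},\qquad \overline B(\sigma)=\inf_{G\in\Delta\mathcal C_{cx}}\ \sup_{t\in T}\frac{\int U(c,t)\,dG(c)}{\int W(c)\,dG(c)},$$ $$\widehat B(\sigma)=\frac{1}{\sigma^{-\sigma/(1-\sigma)}-\sigma-\log(1-\sigma)} .$$ Then $\underline B(\sigma)=\overline B(\sigma)=\widehat B(\sigma)$. Moreover, a saddle point exists, in the following sense. Let $F^*\in\Delta T$ be the distribution of the constant share mechanism $t(q)=z\,u(q)$, where the random share $z\in(0,\sigma]$ has distribution function $-\widehat B(\sigma)\log(1-z)$ for $0\le z<\sigma$ and $1$ for $z\ge\sigma$. For $\gamma>0$ let $q_1=(\sigma/\gamma)^{1/(1-\sigma)}$, $q_0=(1-\sigma)^{1/\sigma}q_1$, $\kappa=(1-\sigma)(\sigma/\gamma)^{\sigma/(1-\sigma)}$, and let $$c_\gamma(q)=\begin{cases}0,&0\le q\le q_0,\\ u(q)-u(q_0)-\kappa\log(q/q_0),&q_0\le q\le q_1,\\ u(q_1)-u(q_0)-\kappa\log(q_1/q_0)+\gamma(q-q_1),&q\ge q_1.\end{cases}$$ This is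 a cost function. For $\theta>\sigma/(1-\sigma)$ let $G_\theta$ be the distribution of $c_\gamma$ when $\gamma\in(0,1]$ has distribution function $\gamma^\theta$; then $G_\theta\in\Delta\mathcal C_{cx}$. The distribution $F^*$, which places weight only on constant share mechanisms, attains the max-min value: $$\min_{c\in\mathcal C_{cx}}\frac{\int U(c,t)\,dF^*(t)}{W(c)}=\widehat B(\sigma);$$ the distributions $G_\theta$ attain the min-max value in the limit: $$\lim_{\theta\downarrow\sigma/(1-\sigma)}\ \sup_{t\in T}\frac{\int U(c,t)\,dG_\theta(c)}{\int W\,dG_\theta}=\widehat B(\sigma);$$ and together they form a saddle point: $$\inf_{G\in\Delta\mathcal C_{cx}}\frac{\iint U(c,t)\,dG(c)\,dF^*(t)}{\int W\,dG}=\widehat B(\sigma)=\lim_{\theta\downarrow\sigma/(1-\sigma)}\ \sup_{F\in\Delta T}\frac{\iint U(c,t)\,dG_\theta(c)\,dF(t)}{\int W\,dG_\theta}.$$ -/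

import Mathlib

open Set Filter Topology MeasureTheory

/-! ### Buyer, seller and mechanisms -/

/-- The buyer's gross utility `u(q) = q ^ σ / σ`. -/
noncomputable def grossUtility (σ q : ℝ) : ℝ := q ^ σ / σ

/-- The cost functions the buyer considers possible: (weakly) increasing and convex on `[0, ∞)`,
with `c(0) = 0`, not identically zero. Only the values on `[0, ∞)` matter anywhere below. -/
structure IsCostFunction (c : ℝ → ℝ) : Prop where
  zero : c 0 = 0
  mono : MonotoneOn c (Ici 0)
  convex : ConvexOn ℝ (Ici 0) c
  nontrivial : ∃ q : ℝ, 0 ≤ q ∧ c q ≠ 0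

/-- The seller's optimal quantities when the cost is `c` and the payment rule is `t`. -/
def bestResponses (c t : ℝ → ℝ) : Set ℝ :=
  {q | 0 ≤ q ∧ ∀ x : ℝ, 0 ≤ x → t x - c x ≤ t q - c q}

/-- A mechanism is a payment rule with `t(0) = 0` under which the quantity supplied, namely the
smallest optimal quantity of the seller, is well defined for every admissible cost function. -/
structure IsMechanism (t : ℝ → ℝ) : Prop where
  zero : t 0 = 0
  response : ∀ c : ℝ → ℝ, IsCostFunction c → ∃ q : ℝ, IsLeast (bestResponses c t) q

/-- The space of admissible cost functions. The parameter `σ` does not restrict the functions; it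
selects the measurable structure given below, which comes from the payoffs. -/
def CostFunction (_σ : ℝ) : Type := {c : ℝ → ℝ // IsCostFunction c}

/-- The space of mechanisms. The parameter `σ` plays the same role as in `CostFunction`. -/
def Mechanism (_σ : ℝ) : Type := {t : ℝ → ℝ // IsMechanism t}

/-- The quantity supplied: the smallest optimal quantity of the seller. -/
noncomputable def supply {σ : ℝ} (c : CostFunction σ) (t : Mechanism σ) : ℝ :=
  sInf (bestResponses c.1 t.1)

/-- The quantity supplied is indeed the least element of the set of optimal quantities. -/
theorem isLeast_supply {σ : ℝ} (c : CostFunction σ) (t : Mechanism σ) :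
    IsLeast (bestResponses c.1 t.1) (supply c t) := by
  obtain ⟨q, hq⟩ := t.2.response c.1 c.2
  have : supply c t = q := hq.csInf_eq
  rwa [this]

/-- The realized buyer surplus `U(c, t) = u(q(c, t)) - t(q(c, t))`. -/
noncomputable def buyerSurplus {σ : ℝ} (c : CostFunction σ) (t : Mechanism σ) : ℝ :=
  grossUtility σ (supply c t) - t.1 (supply c t)

/-- The efficient social surplus `W(c) = max_{q ≥ 0} (u(q) - c(q))`. -/
noncomputable def socialSurplus {σ : ℝ} (c : CostFunction σ) : ℝ :=
  sSup ((fun q : ℝ => grossUtility σ q - c.1 q) '' Ici 0)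

/-! ### Distributions over costs and over mechanisms -/

/-- The coarsest σ-algebra on cost functions for which the social surplus and the buyer surplus
under every mechanism are measurable. -/
noncomputable instance instMeasurableSpaceCostFunction (σ : ℝ) : MeasurableSpace (CostFunction σ) :=
  MeasurableSpace.comap socialSurplus (borel ℝ) ⊔
    ⨆ t : Mechanism σ, MeasurableSpace.comap (fun c => buyerSurplus c t) (borel ℝ)

/-- The integral of an extended real function: integral of the positive part minus integral of the
negative part. Below it is only used for functions bounded above by an integrable function, so it
is a well-defined element of `[-∞, ∞)`. -/
noncomputable def extIntegral {α : Type*} [MeasurableSpace α] (μ : Measure α) (f : α → EReal) :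
    EReal :=
  ((∫⁻ a, (f a).toENNReal ∂μ : ENNReal) : EReal) - ((∫⁻ a, (-f a).toENNReal ∂μ : ENNReal) : EReal)

/-- Distributions over cost functions with finite expected social surplus. -/
structure CostDistribution (σ : ℝ) where
  measure : Measure (CostFunction σ)
  prob : IsProbabilityMeasure measure
  finite_welfare : Integrable socialSurplus measure

/-- The expected social surplus `∫ W(c) dG(c)`. -/
noncomputable def CostDistribution.welfare {σ : ℝ} (G : CostDistribution σ) : ℝ :=
  ∫ c, socialSurplus c ∂G.measure

/-- The expected buyer surplus `∫ U(c, t) dG(c)` of a mechanism under a distribution of costs. -/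
noncomputable def CostDistribution.surplus {σ : ℝ} (G : CostDistribution σ) (t : Mechanism σ) :
    EReal :=
  extIntegral G.measure (fun c => ((buyerSurplus c t : ℝ) : EReal))

/-- The coarsest σ-algebra on mechanisms for which the expected buyer surplus is measurable under
every distribution of costs (in particular `t ↦ U(c, t)` for every cost function `c`). -/
noncomputable instance instMeasurableSpaceMechanism (σ : ℝ) : MeasurableSpace (Mechanism σ) :=
  ⨆ G : CostDistribution σ, MeasurableSpace.comap (fun t => G.surplus t) (borel EReal)

/-! ### Surplus ratios, max-min and min-max values, saddle points -/

/-- `(∫ U(c, t) dF(t)) / W(c)`. -/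
noncomputable def ratioAtCost {σ : ℝ} (F : ProbabilityMeasure (Mechanism σ))
    (c : CostFunction σ) : EReal :=
  extIntegral (F : Measure (Mechanism σ)) (fun t => ((buyerSurplus c t : ℝ) : EReal)) /
    ((socialSurplus c : ℝ) : EReal)

/-- `(∫ U(c, t) dG(c)) / (∫ W(c) dG(c))`. -/
noncomputable def ratioAtMechanism {σ : ℝ} (G : CostDistribution σ) (t : Mechanism σ) : EReal :=
  G.surplus t / ((G.welfare : ℝ) : EReal)

/-- `(∫ ∫ U(c, t) dG(c) dF(t)) / (∫ W(c) dG(c))`. -/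
noncomputable def ratio {σ : ℝ} (F : ProbabilityMeasure (Mechanism σ))
    (G : CostDistribution σ) : EReal :=
  extIntegral (F : Measure (Mechanism σ)) (fun t => G.surplus t) / ((G.welfare : ℝ) : EReal)

/-- The max-min value: the buyer chooses a distribution over mechanisms, then nature a cost. -/
noncomputable def maxMinValue (σ : ℝ) : EReal :=
  ⨆ F : ProbabilityMeasure (Mechanism σ), ⨅ c : CostFunction σ, ratioAtCost F c

/-- The min-max value: nature chooses a distribution over costs, then the buyer a mechanism. -/
noncomputable def minMaxValue (σ : ℝ) : EReal :=
  ⨅ G : CostDistribution σ, ⨆ t : Mechanism σ, ratioAtMechanism G t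

/-- A saddle point whose second component is the limit along `l` of a family of distributions:
`inf_G ratio(F, G) = lim_i sup_{F'} ratio(F', G i)`. For a constant family (and `l` proper) this is
the equality `inf_G ratio(F, G) = sup_{F'} ratio(F', G)`. -/
def IsLimitSaddlePoint {σ : ℝ} {ι : Type*} (l : Filter ι) (F : ProbabilityMeasure (Mechanism σ))
    (G : ι → CostDistribution σ) : Prop :=
  Tendsto (fun i => ⨆ F' : ProbabilityMeasure (Mechanism σ), ratio F' (G i)) l
    (𝓝 (⨅ G' : CostDistribution σ, ratio F G'))

/-- `B̂(σ) = 1 / (σ ^ (-σ / (1 - σ)) - σ - log (1 - σ))`. -/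
noncomputable def saddleValue (σ : ℝ) : ℝ :=
  1 / (σ ^ (-σ / (1 - σ)) - σ - Real.log (1 - σ))

/-! ### Constant share mechanisms -/

theorem IsCostFunction.nonneg {c : ℝ → ℝ} (hc : IsCostFunction c) {q : ℝ} (hq : 0 ≤ q) :
    0 ≤ c q := by
  have := hc.mono (mem_Ici.2 le_rfl) (mem_Ici.2 hq) hq
  rwa [hc.zero] at this

theorem IsCostFunction.le_chord {c : ℝ → ℝ} (hc : IsCostFunction c) {x y : ℝ} (hx : 0 ≤ x)
    (hxy : x ≤ y) (hy : 0 < y) : c x ≤ x / y * c y := by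
  have h := hc.convex.2 (mem_Ici.2 le_rfl) (mem_Ici.2 hy.le)
    (show 0 ≤ 1 - x / y by rw [sub_nonneg, div_le_one hy]; exact hxy)
    (show 0 ≤ x / y by positivity) (by ring)
  simp only [smul_eq_mul, mul_zero, zero_add, hc.zero] at h
  rwa [div_mul_cancel₀ _ hy.ne'] at h

theorem IsCostFunction.continuousOn {c : ℝ → ℝ} (hc : IsCostFunction c) :
    ContinuousOn c (Ici 0) := by
  intro x hx
  rcases (mem_Ici.1 hx).eq_or_lt with rfl | hx0
  · have h1 : Tendsto (fun q : ℝ => q * c 1) (𝓝[Ici 0] 0) (𝓝 0) := by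
      have : Continuous fun q : ℝ => q * c 1 := by fun_prop
      simpa using (this.tendsto 0).mono_left nhdsWithin_le_nhds
    unfold ContinuousWithinAt
    rw [hc.zero]
    refine tendsto_of_tendsto_of_tendsto_of_le_of_le' tendsto_const_nhds h1 ?_ ?_
    · filter_upwards [self_mem_nhdsWithin] with q hq using hc.nonneg hq
    · filter_upwards [self_mem_nhdsWithin,
        mem_nhdsWithin_of_mem_nhds (Iic_mem_nhds (zero_lt_one' ℝ))] with q hq hq1
      simpa using hc.le_chord hq hq1 one_pos
  · have h := hc.convex.continuousOn_interior
    rw [interior_Ici] at h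
    exact (h.continuousAt (Ioi_mem_nhds hx0)).continuousWithinAt

theorem isMechanism_constantShare {σ : ℝ} (hσ : σ ∈ Ioo (0 : ℝ) 1) (z : ℝ) :
    IsMechanism (fun q => z * grossUtility σ q) := by
  have h0 : z * grossUtility σ 0 = 0 := by
    simp [grossUtility, Real.zero_rpow hσ.1.ne']
  refine ⟨h0, fun c hc => ?_⟩
  obtain ⟨a, ha, hca⟩ := hc.nontrivial
  have ha0 : 0 < a := by
    rcases ha.eq_or_lt with rfl | h
    · exact absurd hc.zero hca
    · exact h
  have hca0 : 0 < c a := lt_of_le_of_ne (hc.nonneg ha) (Ne.symm hca)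
  set m := c a / a with hm
  have hm0 : 0 < m := by positivity
  have hgrow : ∀ q, a ≤ q → m * q ≤ c q := by
    intro q hq
    have hq0 : 0 < q := ha0.trans_le hq
    have h := hc.le_chord ha hq hq0
    rw [hm, div_mul_eq_mul_div, div_le_iff₀ ha0]
    have h2 := mul_le_mul_of_nonneg_right h hq0.le
    have h3 : a / q * c q * q = c q * a := by field_simp
    linarith
  set f : ℝ → ℝ := fun q => z * grossUtility σ q - c q with hf
  have hf0 : f 0 = 0 := by simp only [hf]; rw [h0, hc.zero, sub_zero]
  have hlim : Tendsto (fun q : ℝ => q ^ (σ - 1)) atTop (𝓝 0) := by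
    have h := tendsto_rpow_neg_atTop (y := 1 - σ) (by linarith [hσ.2])
    simpa using h
  have hlim2 : Tendsto (fun q : ℝ => z / σ * q ^ (σ - 1)) atTop (𝓝 0) := by
    simpa using hlim.const_mul (z / σ)
  have hev : ∀ᶠ q in atTop, z / σ * q ^ (σ - 1) < m := hlim2.eventually (gt_mem_nhds hm0)
  obtain ⟨R, hR⟩ := eventually_atTop.1 hev
  set R' := max R a with hR'
  have hR'0 : 0 < R' := ha0.trans_le (le_max_right _ _)
  have hneg : ∀ q, R' ≤ q → f q < 0 := by
    intro q hq
    have hq0 : 0 < q := hR'0.trans_le hq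
    have h1 := hR q ((le_max_left _ _).trans hq)
    have h2 := hgrow q ((le_max_right _ _).trans hq)
    have h3 : z * grossUtility σ q = z / σ * q ^ (σ - 1) * q := by
      rw [grossUtility, mul_assoc, ← Real.rpow_add_one hq0.ne', sub_add_cancel]; ring
    have h4 := mul_lt_mul_of_pos_right h1 hq0
    simp only [hf]; rw [h3]; linarith
  have hcont : ContinuousOn f (Icc 0 R') := by
    have hu : Continuous fun q : ℝ => z * grossUtility σ q := by
      unfold grossUtility
      exact continuous_const.mul ((Real.continuous_rpow_const hσ.1.le).div_const _)
    exact hu.continuousOn.sub (hc.continuousOn.mono Icc_subset_Ici_self)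
  obtain ⟨x, hx, hxmax⟩ := isCompact_Icc.exists_isMaxOn (nonempty_Icc.2 hR'0.le) hcont
  have hglob : ∀ y, 0 ≤ y → f y ≤ f x := by
    intro y hy
    by_cases hyR : y ≤ R'
    · exact hxmax ⟨hy, hyR⟩
    · have h1 := hneg y (not_le.1 hyR).le
      have h2 : f 0 ≤ f x := hxmax ⟨le_rfl, hR'0.le⟩
      linarith
  have hK : IsCompact (Icc 0 R' ∩ f ⁻¹' {f x}) :=
    isCompact_Icc.of_isClosed_subset
      (hcont.preimage_isClosed_of_isClosed isClosed_Icc isClosed_singleton) inter_subset_left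
  obtain ⟨q, hq⟩ := hK.exists_isLeast ⟨x, hx, rfl⟩
  refine ⟨q, ⟨hq.1.1.1, fun y hy => ?_⟩, fun y hy => ?_⟩
  · have h1 : f q = f x := hq.1.2
    have h2 := hglob y hy
    rw [← h1] at h2
    exact h2
  · have h1 : f x ≤ f y := hy.2 x hx.1
    have h2 := hglob y hy.1
    have hyR : y ≤ R' := by
      by_contra h
      have h3 := hneg y (not_le.1 h).le
      have h4 : f 0 ≤ f x := hxmax ⟨le_rfl, hR'0.le⟩
      linarith
    exact hq.2 ⟨⟨hy.1, hyR⟩, le_antisymm h2 h1⟩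

/-- The constant share mechanism `t(q) = z * u(q)`. -/
noncomputable def constantShare {σ : ℝ} (hσ : σ ∈ Ioo (0 : ℝ) 1) (z : ℝ) : Mechanism σ :=
  ⟨fun q => z * grossUtility σ q, isMechanism_constantShare hσ z⟩

/-- The distribution of the share `z` with cumulative distribution function `-B̂(σ) log (1 - z)` on
`[0, σ)` and `1` on `[σ, ∞)`: density `B̂(σ) / (1 - z)` on `(0, σ)` and an atom at `σ`. -/
noncomputable def shareLaw (σ : ℝ) : Measure ℝ :=
  (volume.restrict (Ioo 0 σ)).withDensity (fun z => ENNReal.ofReal (saddleValue σ / (1 - z))) +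
    ENNReal.ofReal (1 + saddleValue σ * Real.log (1 - σ)) • Measure.dirac σ

/-! ### The critical cost functions -/

/-- Upper kink `q₁ = (σ / γ) ^ (1 / (1 - σ))`. -/
noncomputable def upperKink (σ γ : ℝ) : ℝ := (σ / γ) ^ (1 / (1 - σ))

/-- Lower kink `q₀ = (1 - σ) ^ (1 / σ) * (σ / γ) ^ (1 / (1 - σ))`. -/
noncomputable def lowerKink (σ γ : ℝ) : ℝ := (1 - σ) ^ (1 / σ) * (σ / γ) ^ (1 / (1 - σ))

/-- `κ = (1 - σ) * (σ / γ) ^ (σ / (1 - σ))`. -/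
noncomputable def logCoeff (σ γ : ℝ) : ℝ := (1 - σ) * (σ / γ) ^ (σ / (1 - σ))

/-- Middle branch `u(q) - u(q₀) - κ log (q / q₀)` of the critical cost function. -/
noncomputable def middleCost (σ γ q : ℝ) : ℝ :=
  grossUtility σ q - grossUtility σ (lowerKink σ γ) -
    logCoeff σ γ * Real.log (q / lowerKink σ γ)

/-- The critical cost function with parameter `γ`: zero up to `q₀`, then the middle branch up to
`q₁`, then linear with slope `γ`. -/
noncomputable def criticalCostFun (σ γ q : ℝ) : ℝ :=
  if q ≤ lowerKink σ γ then 0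
  else if q ≤ upperKink σ γ then middleCost σ γ q
  else middleCost σ γ (upperKink σ γ) + γ * (q - upperKink σ γ)

theorem hasDerivAt_glue {f g : ℝ → ℝ} {a d : ℝ} (hf : HasDerivAt f d a) (hg : HasDerivAt g d a)
    (hfg : f a = g a) : HasDerivAt (fun x => if x ≤ a then f x else g x) d a := by
  have h1 : HasDerivWithinAt (fun x => if x ≤ a then f x else g x) d (Iic a) a :=
    hf.hasDerivWithinAt.congr (fun x hx => by simp [mem_Iic.1 hx]) (by simp)
  have h2 : HasDerivWithinAt (fun x => if x ≤ a then f x else g x) d (Ici a) a := by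
    refine hg.hasDerivWithinAt.congr (fun x hx => ?_) (by simp [hfg])
    rcases (mem_Ici.1 hx).eq_or_lt with rfl | h
    · simp [hfg]
    · simp [not_le.2 h]
  have h := h1.union h2
  rw [Iic_union_Ici] at h
  exact h.hasDerivAt univ_mem

/-- The marginal cost of the critical cost function. -/
noncomputable def criticalMarginal (σ γ q : ℝ) : ℝ :=
  if q ≤ lowerKink σ γ then 0
  else if q ≤ upperKink σ γ then q ^ (σ - 1) - logCoeff σ γ / q
  else γ

section Critical

theorem kinks_pos {σ γ : ℝ} (hσ : σ ∈ Ioo (0 : ℝ) 1) (hγ : 0 < γ) :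
    0 < lowerKink σ γ ∧ lowerKink σ γ < upperKink σ γ := by
  have h1 : 0 < 1 - σ := by linarith [hσ.2]
  have hσ0 := hσ.1
  have h2 : 0 < (σ / γ) ^ (1 / (1 - σ)) := Real.rpow_pos_of_pos (by positivity) _
  have h3 : 0 < (1 - σ) ^ (1 / σ) := Real.rpow_pos_of_pos h1 _
  have h4 : (1 - σ) ^ (1 / σ) < 1 :=
    Real.rpow_lt_one h1.le (by linarith) (by positivity)
  refine ⟨mul_pos h3 h2, ?_⟩
  unfold lowerKink upperKink
  nlinarith

theorem lowerKink_rpow {σ γ : ℝ} (hσ : σ ∈ Ioo (0 : ℝ) 1) (hγ : 0 < γ) :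
    lowerKink σ γ ^ σ = logCoeff σ γ := by
  have h1 : 0 < 1 - σ := by linarith [hσ.2]
  have hσ0 := hσ.1
  have hb : 0 < σ / γ := by positivity
  rw [lowerKink, logCoeff, Real.mul_rpow (by positivity) (by positivity), ← Real.rpow_mul h1.le,
    ← Real.rpow_mul hb.le, one_div_mul_cancel hσ0.ne', Real.rpow_one]
  congr 2
  ring

theorem upperKink_rpow {σ γ : ℝ} (hσ : σ ∈ Ioo (0 : ℝ) 1) (hγ : 0 < γ) :
    logCoeff σ γ = (1 - σ) * upperKink σ γ ^ σ := by
  have hσ0 := hσ.1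
  have hb : 0 < σ / γ := by positivity
  rw [upperKink, logCoeff, ← Real.rpow_mul hb.le]
  congr 2
  ring

theorem upperKink_rpow_sub_one {σ γ : ℝ} (hσ : σ ∈ Ioo (0 : ℝ) 1) (hγ : 0 < γ) :
    upperKink σ γ ^ (σ - 1) = γ / σ := by
  have hσ0 := hσ.1
  have h1 : 1 - σ ≠ 0 := by linarith [hσ.2]
  have hb : 0 < σ / γ := by positivity
  rw [upperKink, ← Real.rpow_mul hb.le]
  have : 1 / (1 - σ) * (σ - 1) = -1 := by field_simp; ring
  rw [this, Real.rpow_neg_one, inv_div]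

theorem hasDerivAt_middleCost {σ γ q : ℝ} (hσ : σ ∈ Ioo (0 : ℝ) 1) (hγ : 0 < γ) (hq : 0 < q) :
    HasDerivAt (middleCost σ γ) (q ^ (σ - 1) - logCoeff σ γ / q) q := by
  have hl := (kinks_pos hσ hγ).1
  have h1 : HasDerivAt (grossUtility σ) (q ^ (σ - 1)) q := by
    have h := (Real.hasDerivAt_rpow_const (p := σ) (Or.inl hq.ne')).div_const σ
    rwa [mul_div_cancel_left₀ _ hσ.1.ne'] at h
  have h2 : HasDerivAt (fun x => Real.log (x / lowerKink σ γ)) (1 / q) q := by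
    have h := ((hasDerivAt_id q).div_const (lowerKink σ γ)).log (div_pos hq hl).ne'
    have he : 1 / lowerKink σ γ / (id q / lowerKink σ γ) = 1 / q := by
      simp only [id]; field_simp
    rwa [he] at h
  have h3 := (h1.sub_const (grossUtility σ (lowerKink σ γ))).sub (h2.const_mul (logCoeff σ γ))
  rw [mul_one_div] at h3
  exact h3

theorem hasDerivAt_criticalCostFun {σ γ q : ℝ} (hσ : σ ∈ Ioo (0 : ℝ) 1) (hγ : 0 < γ)
    (hq : 0 < q) : HasDerivAt (criticalCostFun σ γ) (criticalMarginal σ γ q) q := by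
  obtain ⟨hl, hlu⟩ := kinks_pos hσ hγ
  have hmid0 : middleCost σ γ (lowerKink σ γ) = 0 := by
    simp [middleCost, div_self hl.ne']
  have hlin : ∀ x, HasDerivAt
      (fun q => middleCost σ γ (upperKink σ γ) + γ * (q - upperKink σ γ)) γ x := by
    intro x
    simpa using (((hasDerivAt_id x).sub_const (upperKink σ γ)).const_mul γ).const_add
      (middleCost σ γ (upperKink σ γ))
  have hmu : upperKink σ γ ^ (σ - 1) - logCoeff σ γ / upperKink σ γ = γ := by
    have hu := hl.trans hlu
    rw [upperKink_rpow hσ hγ, mul_div_assoc, ← Real.rpow_sub_one hu.ne',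
      upperKink_rpow_sub_one hσ hγ]
    have hσ0 := hσ.1.ne'
    field_simp
    ring
  have hml : lowerKink σ γ ^ (σ - 1) - logCoeff σ γ / lowerKink σ γ = 0 := by
    rw [← lowerKink_rpow hσ hγ, ← Real.rpow_sub_one hl.ne', sub_self]
  rcases lt_trichotomy q (lowerKink σ γ) with h | h | h
  · rw [criticalMarginal, if_pos h.le]
    refine (hasDerivAt_const q (0 : ℝ)).congr_of_eventuallyEq ?_
    filter_upwards [Iio_mem_nhds h] with x hx
    rw [criticalCostFun, if_pos (le_of_lt hx)]
  · subst h
    rw [criticalMarginal, if_pos le_rfl]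
    have hm := hasDerivAt_middleCost hσ hγ hl
    rw [hml] at hm
    have hg := hasDerivAt_glue (hasDerivAt_const (lowerKink σ γ) (0 : ℝ)) hm hmid0.symm
    refine hg.congr_of_eventuallyEq ?_
    filter_upwards [Iio_mem_nhds hlu] with x hx
    have hx' : x ≤ upperKink σ γ := le_of_lt (mem_Iio.1 hx)
    simp only [criticalCostFun, if_pos hx']
  · rcases lt_trichotomy q (upperKink σ γ) with h' | h' | h'
    · rw [criticalMarginal, if_neg (not_le.2 h), if_pos h'.le]
      refine (hasDerivAt_middleCost hσ hγ hq).congr_of_eventuallyEq ?_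
      filter_upwards [Ioi_mem_nhds h, Iio_mem_nhds h'] with x hx hx'
      rw [criticalCostFun, if_neg (not_le.2 hx), if_pos (le_of_lt hx')]
    · subst h'
      rw [criticalMarginal, if_neg (not_le.2 h), if_pos le_rfl]
      have hm := hasDerivAt_middleCost hσ hγ hq
      rw [hmu] at hm ⊢
      have hg := hasDerivAt_glue hm (hlin (upperKink σ γ)) (by simp)
      refine hg.congr_of_eventuallyEq ?_
      filter_upwards [Ioi_mem_nhds h] with x hx
      have hx' : ¬ x ≤ lowerKink σ γ := not_le.2 (mem_Ioi.1 hx)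
      simp only [criticalCostFun, if_neg hx']
    · rw [criticalMarginal, if_neg (not_le.2 h), if_neg (not_le.2 h')]
      refine (hlin q).congr_of_eventuallyEq ?_
      filter_upwards [Ioi_mem_nhds h, Ioi_mem_nhds h'] with x hx hx'
      rw [criticalCostFun, if_neg (not_le.2 hx), if_neg (not_le.2 hx')]

theorem monotoneOn_middleMarginal {σ γ : ℝ} (hσ : σ ∈ Ioo (0 : ℝ) 1) (hγ : 0 < γ) :
    MonotoneOn (fun q => q ^ (σ - 1) - logCoeff σ γ / q)
      (Icc (lowerKink σ γ) (upperKink σ γ)) := by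
  obtain ⟨hl, hlu⟩ := kinks_pos hσ hγ
  have hd : ∀ q : ℝ, 0 < q → HasDerivAt (fun q => q ^ (σ - 1) - logCoeff σ γ / q)
      ((σ - 1) * q ^ (σ - 1 - 1) + logCoeff σ γ / q ^ 2) q := by
    intro q hq
    have h1 := Real.hasDerivAt_rpow_const (x := q) (p := σ - 1) (Or.inl hq.ne')
    have h2 := (hasDerivAt_inv hq.ne').const_mul (logCoeff σ γ)
    refine (h1.sub h2).congr_deriv ?_
    field_simp
    ring
  refine monotoneOn_of_deriv_nonneg (convex_Icc _ _)
    (fun q hq => (hd q (hl.trans_le hq.1)).continuousAt.continuousWithinAt)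
    (fun q hq => ?_) (fun q hq => ?_)
  · rw [interior_Icc] at hq
    exact (hd q (hl.trans hq.1)).differentiableAt.differentiableWithinAt
  · rw [interior_Icc] at hq
    have hq0 := hl.trans hq.1
    rw [(hd q hq0).deriv, upperKink_rpow hσ hγ]
    have h1 : q ^ (σ - 1 - 1) = q ^ σ / q ^ 2 := by
      rw [show σ - 1 - 1 = σ - (2 : ℕ) by push_cast; ring, Real.rpow_sub hq0, Real.rpow_natCast]
    have h2 : q ^ σ ≤ upperKink σ γ ^ σ := Real.rpow_le_rpow hq0.le hq.2.le hσ.1.le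
    rw [h1]
    have h3 : (σ - 1) * (q ^ σ / q ^ 2) + (1 - σ) * upperKink σ γ ^ σ / q ^ 2 =
        (1 - σ) * (upperKink σ γ ^ σ - q ^ σ) / q ^ 2 := by ring
    rw [h3]
    have h4 : 0 ≤ 1 - σ := by linarith [hσ.2]
    have h5 := sub_nonneg.2 h2
    positivity

theorem criticalMarginal_bounds {σ γ q : ℝ} (hσ : σ ∈ Ioo (0 : ℝ) 1) (hγ : 0 < γ)
    (h1 : lowerKink σ γ ≤ q) (h2 : q ≤ upperKink σ γ) :
    0 ≤ q ^ (σ - 1) - logCoeff σ γ / q ∧ q ^ (σ - 1) - logCoeff σ γ / q ≤ γ := by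
  obtain ⟨hl, hlu⟩ := kinks_pos hσ hγ
  have hm := monotoneOn_middleMarginal hσ hγ
  have ha := hm ⟨le_rfl, hlu.le⟩ ⟨h1, h2⟩ h1
  have hb := hm ⟨h1, h2⟩ ⟨hlu.le, le_rfl⟩ h2
  simp only at ha hb
  have hml : lowerKink σ γ ^ (σ - 1) - logCoeff σ γ / lowerKink σ γ = 0 := by
    rw [← lowerKink_rpow hσ hγ, ← Real.rpow_sub_one hl.ne', sub_self]
  have hmu : upperKink σ γ ^ (σ - 1) - logCoeff σ γ / upperKink σ γ = γ := by
    have hu := hl.trans hlu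
    rw [upperKink_rpow hσ hγ, mul_div_assoc, ← Real.rpow_sub_one hu.ne',
      upperKink_rpow_sub_one hσ hγ]
    have hσ0 := hσ.1.ne'
    field_simp
    ring
  exact ⟨hml ▸ ha, hb.trans hmu.le⟩

theorem criticalMarginal_nonneg {σ γ : ℝ} (hσ : σ ∈ Ioo (0 : ℝ) 1) (hγ : 0 < γ) (q : ℝ) :
    0 ≤ criticalMarginal σ γ q := by
  unfold criticalMarginal
  split_ifs with h1 h2
  · exact le_rfl
  · exact (criticalMarginal_bounds hσ hγ (not_le.1 h1).le h2).1
  · exact hγ.le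

theorem monotone_criticalMarginal {σ γ : ℝ} (hσ : σ ∈ Ioo (0 : ℝ) 1) (hγ : 0 < γ) :
    Monotone (criticalMarginal σ γ) := by
  intro x y hxy
  by_cases hx : x ≤ lowerKink σ γ
  · rw [criticalMarginal, if_pos hx]
    exact criticalMarginal_nonneg hσ hγ y
  · have hy : ¬ y ≤ lowerKink σ γ := fun h => hx (hxy.trans h)
    by_cases hyu : y ≤ upperKink σ γ
    · have hxu := hxy.trans hyu
      rw [criticalMarginal, criticalMarginal, if_neg hx, if_neg hy, if_pos hxu, if_pos hyu]
      exact monotoneOn_middleMarginal hσ hγ ⟨(not_le.1 hx).le, hxu⟩ ⟨(not_le.1 hy).le, hyu⟩ hxy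
    · rw [criticalMarginal, criticalMarginal, if_neg hx, if_neg hy, if_neg hyu]
      split_ifs with hxu
      · exact (criticalMarginal_bounds hσ hγ (not_le.1 hx).le hxu).2
      · exact le_rfl

theorem isCostFunction_critical {σ γ : ℝ} (hσ : σ ∈ Ioo (0 : ℝ) 1) (hγ : 0 < γ) :
    IsCostFunction (criticalCostFun σ γ) := by
  obtain ⟨hl, hlu⟩ := kinks_pos hσ hγ
  have hd := fun q (hq : 0 < q) => hasDerivAt_criticalCostFun hσ hγ hq
  have hcont : ContinuousOn (criticalCostFun σ γ) (Ici 0) := by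
    intro q hq
    rcases (mem_Ici.1 hq).eq_or_lt with rfl | h
    · refine ContinuousAt.continuousWithinAt ?_
      refine (continuousAt_const (y := (0 : ℝ))).congr ?_
      filter_upwards [Iio_mem_nhds hl] with x hx
      rw [criticalCostFun, if_pos (le_of_lt hx)]
    · exact (hd q h).continuousAt.continuousWithinAt
  have hdiff : DifferentiableOn ℝ (criticalCostFun σ γ) (interior (Ici 0)) := by
    intro q hq
    rw [interior_Ici] at hq
    exact (hd q hq).differentiableAt.differentiableWithinAt
  have hmono : MonotoneOn (criticalCostFun σ γ) (Ici 0) := by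
    refine monotoneOn_of_deriv_nonneg (convex_Ici 0) hcont hdiff fun q hq => ?_
    rw [interior_Ici] at hq
    rw [(hd q hq).deriv]
    exact criticalMarginal_nonneg hσ hγ q
  refine ⟨by rw [criticalCostFun, if_pos hl.le], hmono, ?_, ?_⟩
  · refine MonotoneOn.convexOn_of_deriv (convex_Ici 0) hcont hdiff ?_
    rw [interior_Ici]
    intro x hx y hy hxy
    rw [(hd x hx).deriv, (hd y hy).deriv]
    exact monotone_criticalMarginal hσ hγ hxy
  · have hu := hl.trans hlu
    refine ⟨upperKink σ γ + 1, by linarith, ?_⟩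
    have h1 : 0 ≤ criticalCostFun σ γ (upperKink σ γ) := by
      have h := hmono (mem_Ici.2 le_rfl) (mem_Ici.2 hu.le) hu.le
      rwa [show criticalCostFun σ γ 0 = 0 by rw [criticalCostFun, if_pos hl.le]] at h
    rw [criticalCostFun, if_neg (not_le.2 hlu), if_pos le_rfl] at h1
    rw [criticalCostFun, if_neg (by linarith), if_neg (by linarith)]
    have : 0 < middleCost σ γ (upperKink σ γ) + γ * (upperKink σ γ + 1 - upperKink σ γ) := by
      rw [add_sub_cancel_left, mul_one]; linarith
    exact this.ne'

end Critical

/-- The critical cost function as an admissible cost function. -/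
noncomputable def criticalCost {σ : ℝ} (hσ : σ ∈ Ioo (0 : ℝ) 1) (γ : Ioi (0 : ℝ)) :
    CostFunction σ :=
  ⟨criticalCostFun σ γ, isCostFunction_critical hσ γ.2⟩

/-- The power distribution on `(0, 1]` with cumulative distribution function `γ ^ θ`. -/
noncomputable def powerLaw (θ : ℝ) : Measure (Ioi (0 : ℝ)) :=
  Measure.comap Subtype.val
    ((volume.restrict (Ioc 0 1)).withDensity (fun γ : ℝ => ENNReal.ofReal (θ * γ ^ (θ - 1))))

/-! The proof bounds the buyer's guarantee from below through the random constant share and from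
above through the critical cost functions, and the two bounds meet at `B̂ = saddleValue σ`.

*Lower bound.* Under the share `z` the buyer keeps `(1 - z) u(q_z)`, and the density of the random
share is proportional to `1 / (1 - z)` on `(0, σ)`, so the expected buyer surplus is `B̂` times
`∫_0^σ u(q_z) dz + (1 - σ) (σ ^ (-σ / (1 - σ)) - σ) u(q_σ)`. By the envelope theorem the integral is
the seller's profit under the share `σ`. The first-order condition at `q_σ` gives a supporting line
of the convex cost function, and replacing the cost by this line shows that the bracket is at least
`W(c)` (`socialSurplus_le_share`), with equality for linear costs. For a distribution `G` of costs,
the envelope theorem is used through finite Riemann sums which are integrated against `G` before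
the mesh tends to zero (`welfare_le_expectedUtility`); this needs no joint measurability.

*Upper bound.* Dividing `γ` by `k > 1` scales the power law with exponent `θ` by at most `k ^ θ`. A
seller with parameter `γ / k` can imitate one with parameter `γ`; integrating this inequality gives
a lower bound on the expected profit in terms of the expected information rent, hence an upper bound
on the buyer surplus by the expectation of a virtual surplus (`lintegral_gap_ge`). The critical cost
functions are such that, as `k` tends to one and `θ` to `σ / (1 - σ)`, the virtual surplus becomes
constant in the quantity on the middle branch and maximal there (`virtualSurplus_le`,
`tendsto_virtualBound`), and the bound on the ratio tends to `B̂` (`tendsto_criticalBound`).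

The max-min value requires exchanging the integral over costs with the integral over an arbitrary
distribution of mechanisms. The estimate of `lintegral_gap_ge` only uses the scaling property, so it
also holds for the geometric law on the parameters `k ^ (-i)`, where the exchange concerns a
countable sum (`iInf_ratioAtCost_le`). -/

/-! ### Extended integrals -/

theorem extIntegral_mono_ae {α : Type*} [MeasurableSpace α] {μ : Measure α} {f g : α → EReal}
    (h : ∀ᵐ a ∂μ, f a ≤ g a) : extIntegral μ f ≤ extIntegral μ g := by
  refine EReal.sub_le_sub ?_ ?_
  · refine EReal.coe_ennreal_le_coe_ennreal_iff.2 (lintegral_mono_ae ?_)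
    filter_upwards [h] with a ha using EReal.toENNReal_le_toENNReal ha
  · refine EReal.coe_ennreal_le_coe_ennreal_iff.2 (lintegral_mono_ae ?_)
    filter_upwards [h] with a ha
    exact EReal.toENNReal_le_toENNReal (EReal.neg_le_neg_iff.2 ha)

theorem extIntegral_of_nonneg {α : Type*} [MeasurableSpace α] {μ : Measure α} {f : α → EReal}
    (h : ∀ᵐ a ∂μ, 0 ≤ f a) : extIntegral μ f = ((∫⁻ a, (f a).toENNReal ∂μ : ENNReal) : EReal) := by
  have h0 : ∫⁻ a, (-f a).toENNReal ∂μ = 0 := by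
    rw [← lintegral_zero (μ := μ)]
    refine lintegral_congr_ae ?_
    filter_upwards [h] with a ha
    exact EReal.toENNReal_of_nonpos (by simpa using ha)
  rw [extIntegral, h0]
  simp

theorem extIntegral_const {α : Type*} [MeasurableSpace α] {μ : Measure α} [IsProbabilityMeasure μ]
    (x : ℝ) : extIntegral μ (fun _ => (x : EReal)) = x := by
  simp only [extIntegral, lintegral_const, measure_univ, mul_one, ← EReal.coe_neg,
    EReal.real_coe_toENNReal]
  rw [EReal.coe_ennreal_ofReal, EReal.coe_ennreal_ofReal, ← EReal.coe_sub,
    max_zero_sub_max_neg_zero_eq_self]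

/-- For `f` below a nonnegative integrable function `g`, the integral of `f` is that of `g` minus
that of the nonnegative gap `g - f`. All estimates below are estimates of such gaps, which only
involve integrals of nonnegative functions. -/
theorem extIntegral_eq_sub_gap {α : Type*} [MeasurableSpace α] {μ : Measure α} {f g : α → ℝ}
    (hf : Measurable f) (hg0 : ∀ a, 0 ≤ g a) (hfg : ∀ a, f a ≤ g a)
    (hg : Integrable g μ) :
    extIntegral μ (fun a => (f a : EReal)) =
      ((∫ a, g a ∂μ : ℝ) : EReal) - ((∫⁻ a, ENNReal.ofReal (g a - f a) ∂μ : ENNReal) : EReal) := by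
  have hgl : ENNReal.ofReal (∫ a, g a ∂μ) = ∫⁻ a, ENNReal.ofReal (g a) ∂μ :=
    ofReal_integral_eq_lintegral_ofReal hg (ae_of_all _ hg0)
  have hw : 0 ≤ ∫ a, g a ∂μ := integral_nonneg hg0
  have hP : ∫⁻ a, ENNReal.ofReal (f a) ∂μ ≠ ⊤ := by
    refine ne_top_of_le_ne_top (hgl ▸ ENNReal.ofReal_ne_top) ?_
    exact lintegral_mono fun a => ENNReal.ofReal_le_ofReal (hfg a)
  have hsum : ∫⁻ a, ENNReal.ofReal (g a - f a) ∂μ + ∫⁻ a, ENNReal.ofReal (f a) ∂μ =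
      ∫⁻ a, ENNReal.ofReal (g a) ∂μ + ∫⁻ a, ENNReal.ofReal (-f a) ∂μ := by
    rw [← lintegral_add_right _ (by fun_prop), ← lintegral_add_right _ (by fun_prop)]
    refine lintegral_congr fun a => ?_
    rcases le_total 0 (f a) with h | h
    · rw [← ENNReal.ofReal_add (sub_nonneg.2 (hfg a)) h,
        ENNReal.ofReal_of_nonpos (neg_nonpos.2 h)]
      simp
    · rw [ENNReal.ofReal_of_nonpos h, ← ENNReal.ofReal_add (hg0 a) (neg_nonneg.2 h)]
      simp [sub_eq_add_neg]
  rw [← hgl] at hsum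
  have hunf : extIntegral μ (fun a => (f a : EReal)) =
      ((∫⁻ a, ENNReal.ofReal (f a) ∂μ : ENNReal) : EReal) -
        ((∫⁻ a, ENNReal.ofReal (-f a) ∂μ : ENNReal) : EReal) := by
    simp only [extIntegral, ← EReal.coe_neg, EReal.real_coe_toENNReal]
  rw [hunf]
  generalize ∫⁻ a, ENNReal.ofReal (f a) ∂μ = P at *
  generalize ∫⁻ a, ENNReal.ofReal (-f a) ∂μ = N at *
  generalize ∫⁻ a, ENNReal.ofReal (g a - f a) ∂μ = A at *
  generalize ∫ a, g a ∂μ = w at *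
  lift P to NNReal using hP
  by_cases hN : N = ⊤
  · have hA : A = ⊤ := by
      subst hN
      by_contra hA
      rw [add_top] at hsum
      exact (ENNReal.add_ne_top.2 ⟨hA, ENNReal.coe_ne_top⟩) hsum
    subst hN hA
    simp [EReal.coe_ennreal_top]
  · have hA : A ≠ ⊤ := by
      rintro rfl
      rw [top_add] at hsum
      exact (ENNReal.add_ne_top.2 ⟨ENNReal.ofReal_ne_top, hN⟩) hsum.symm
    lift N to NNReal using hN
    lift A to NNReal using hA
    have h := congrArg ENNReal.toReal hsum
    rw [ENNReal.toReal_add (by simp) (by simp), ENNReal.toReal_add (by simp) (by simp),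
      ENNReal.toReal_ofReal hw] at h
    simp only [ENNReal.coe_toReal] at h
    simp only [EReal.coe_nnreal_eq_coe_real]
    rw [← EReal.coe_sub, ← EReal.coe_sub]
    congr 1
    linarith

/-- A lower bound on the gap gives an upper bound on the integral. -/
theorem extIntegral_le_of_le_gap {α : Type*} [MeasurableSpace α] {μ : Measure α} {f g : α → ℝ}
    (hf : Measurable f) (hg0 : ∀ a, 0 ≤ g a) (hfg : ∀ a, f a ≤ g a)
    (hg : Integrable g μ) {x : ℝ}
    (hx : ENNReal.ofReal (∫ a, g a ∂μ - x) ≤ ∫⁻ a, ENNReal.ofReal (g a - f a) ∂μ) :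
    extIntegral μ (fun a => (f a : EReal)) ≤ x := by
  rw [extIntegral_eq_sub_gap hf hg0 hfg hg]
  have h1 : ((∫ a, g a ∂μ - x : ℝ) : EReal) ≤
      ((∫⁻ a, ENNReal.ofReal (g a - f a) ∂μ : ENNReal) : EReal) := by
    refine le_trans ?_ (EReal.coe_ennreal_le_coe_ennreal_iff.2 hx)
    rw [EReal.coe_ennreal_ofReal]
    exact EReal.coe_le_coe_iff.2 (le_max_left _ _)
  refine (EReal.sub_le_sub le_rfl h1).trans ?_
  rw [← EReal.coe_sub, sub_sub_cancel]

/-- A lower bound on the integral gives an upper bound on the gap. -/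
theorem gap_le_of_le_extIntegral {α : Type*} [MeasurableSpace α] {μ : Measure α} {f g : α → ℝ}
    (hf : Measurable f) (hg0 : ∀ a, 0 ≤ g a) (hfg : ∀ a, f a ≤ g a)
    (hg : Integrable g μ) {x : ℝ} (hx : (x : EReal) ≤ extIntegral μ (fun a => (f a : EReal))) :
    ∫⁻ a, ENNReal.ofReal (g a - f a) ∂μ ≤ ENNReal.ofReal (∫ a, g a ∂μ - x) := by
  rw [extIntegral_eq_sub_gap hf hg0 hfg hg] at hx
  generalize ∫⁻ a, ENNReal.ofReal (g a - f a) ∂μ = A at *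
  by_cases hA : A = ⊤
  · subst hA
    simp [EReal.coe_ennreal_top] at hx
  · lift A to NNReal using hA
    simp only [EReal.coe_nnreal_eq_coe_real, ← EReal.coe_sub,
      EReal.coe_le_coe_iff] at hx
    rw [← ENNReal.ofReal_coe_nnreal]
    exact ENNReal.ofReal_le_ofReal (by linarith)

/-! ### Surpluses and their measurability -/

section Surplus

variable {σ : ℝ}

theorem grossUtility_zero (hσ : σ ∈ Ioo (0 : ℝ) 1) : grossUtility σ 0 = 0 := by
  simp [grossUtility, Real.zero_rpow hσ.1.ne']

theorem grossUtility_nonneg (hσ : σ ∈ Ioo (0 : ℝ) 1) {q : ℝ} (hq : 0 ≤ q) :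
    0 ≤ grossUtility σ q :=
  div_nonneg (Real.rpow_nonneg hq σ) hσ.1.le

theorem grossUtility_mono (hσ : σ ∈ Ioo (0 : ℝ) 1) {x y : ℝ} (hx : 0 ≤ x) (hxy : x ≤ y) :
    grossUtility σ x ≤ grossUtility σ y :=
  div_le_div_of_nonneg_right (Real.rpow_le_rpow hx hxy hσ.1.le) hσ.1.le

theorem supply_nonneg (c : CostFunction σ) (t : Mechanism σ) : 0 ≤ supply c t :=
  (isLeast_supply c t).1.1

theorem supply_optimal (c : CostFunction σ) (t : Mechanism σ) {x : ℝ} (hx : 0 ≤ x) :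
    t.1 x - c.1 x ≤ t.1 (supply c t) - c.1 (supply c t) :=
  (isLeast_supply c t).1.2 x hx

/-- Quantities below the supplied one are strictly worse for the seller. -/
theorem lt_of_lt_supply (c : CostFunction σ) (t : Mechanism σ) {x : ℝ} (hx : 0 ≤ x)
    (hlt : x < supply c t) : t.1 x - c.1 x < t.1 (supply c t) - c.1 (supply c t) := by
  refine lt_of_le_of_ne (supply_optimal c t hx) fun h => ?_
  exact absurd ((isLeast_supply c t).2 ⟨hx, fun y hy => h ▸ supply_optimal c t hy⟩) (not_le.2 hlt)

theorem profit_nonneg (c : CostFunction σ) (t : Mechanism σ) :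
    0 ≤ t.1 (supply c t) - c.1 (supply c t) := by
  have h := supply_optimal c t le_rfl
  rwa [t.2.zero, c.2.zero, sub_zero] at h

/-- The supremum defining the social surplus is attained, at the supply under the constant share
mechanism that passes the whole gross utility on to the seller. -/
theorem isGreatest_socialSurplus (hσ : σ ∈ Ioo (0 : ℝ) 1) (c : CostFunction σ) :
    IsGreatest ((fun q : ℝ => grossUtility σ q - c.1 q) '' Ici 0) (socialSurplus c) := by
  have h : IsGreatest ((fun q : ℝ => grossUtility σ q - c.1 q) '' Ici 0)
      (grossUtility σ (supply c (constantShare hσ 1)) - c.1 (supply c (constantShare hσ 1))) := by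
    refine ⟨⟨_, supply_nonneg _ _, rfl⟩, ?_⟩
    rintro _ ⟨x, hx, rfl⟩
    simpa [constantShare] using supply_optimal c (constantShare hσ 1) hx
  rwa [socialSurplus, h.csSup_eq]

theorem le_socialSurplus (hσ : σ ∈ Ioo (0 : ℝ) 1) (c : CostFunction σ) {q : ℝ} (hq : 0 ≤ q) :
    grossUtility σ q - c.1 q ≤ socialSurplus c :=
  (isGreatest_socialSurplus hσ c).2 ⟨q, hq, rfl⟩

theorem socialSurplus_le (hσ : σ ∈ Ioo (0 : ℝ) 1) (c : CostFunction σ) {x : ℝ}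
    (h : ∀ q, 0 ≤ q → grossUtility σ q - c.1 q ≤ x) : socialSurplus c ≤ x := by
  obtain ⟨q, hq, hq'⟩ := (isGreatest_socialSurplus hσ c).1
  exact hq' ▸ h q hq

theorem socialSurplus_nonneg (hσ : σ ∈ Ioo (0 : ℝ) 1) (c : CostFunction σ) :
    0 ≤ socialSurplus c := by
  have h := le_socialSurplus hσ c le_rfl
  rwa [grossUtility_zero hσ, c.2.zero, sub_zero] at h

theorem buyerSurplus_le_socialSurplus (hσ : σ ∈ Ioo (0 : ℝ) 1) (c : CostFunction σ)
    (t : Mechanism σ) : buyerSurplus c t ≤ socialSurplus c := by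
  have h1 := profit_nonneg c t
  have h2 := le_socialSurplus hσ c (supply_nonneg c t)
  unfold buyerSurplus
  linarith

theorem measurable_socialSurplus : Measurable (socialSurplus (σ := σ)) :=
  measurable_iff_comap_le.2 le_sup_left

theorem measurable_buyerSurplus (t : Mechanism σ) :
    Measurable fun c : CostFunction σ => buyerSurplus c t :=
  measurable_iff_comap_le.2 (le_sup_of_le_right
    (le_iSup (fun t : Mechanism σ => MeasurableSpace.comap (fun c => buyerSurplus c t) (borel ℝ)) t))

theorem measurable_surplus (G : CostDistribution σ) :
    Measurable fun t : Mechanism σ => G.surplus t :=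
  measurable_iff_comap_le.2 (le_iSup
    (fun G : CostDistribution σ => MeasurableSpace.comap (fun t => G.surplus t) (borel EReal)) G)

/-- A map into cost functions is measurable once the social surplus and all buyer surpluses are
measurable along it. -/
theorem measurable_to_costFunction {α : Type*} [MeasurableSpace α] {f : α → CostFunction σ}
    (hW : Measurable fun a => socialSurplus (f a))
    (hU : ∀ t, Measurable fun a => buyerSurplus (f a) t) : Measurable f := by
  rw [measurable_iff_comap_le, instMeasurableSpaceCostFunction, MeasurableSpace.comap_sup,
    MeasurableSpace.comap_iSup]
  refine sup_le ?_ (iSup_le fun t => ?_)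
  · rw [MeasurableSpace.comap_comp]
    exact measurable_iff_comap_le.1 hW
  · rw [MeasurableSpace.comap_comp]
    exact measurable_iff_comap_le.1 (hU t)

/-- A map into mechanisms is measurable once all expected buyer surpluses are measurable
along it. -/
theorem measurable_to_mechanism {α : Type*} [MeasurableSpace α] {f : α → Mechanism σ}
    (hf : ∀ G : CostDistribution σ, Measurable fun a => G.surplus (f a)) : Measurable f := by
  rw [measurable_iff_comap_le, instMeasurableSpaceMechanism, MeasurableSpace.comap_iSup]
  refine iSup_le fun G => ?_
  rw [MeasurableSpace.comap_comp]
  exact measurable_iff_comap_le.1 (hf G)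

/-- The degenerate distribution at a single cost function. -/
noncomputable def CostDistribution.dirac (c : CostFunction σ) : CostDistribution σ where
  measure := Measure.dirac c
  prob := inferInstance
  finite_welfare := by
    refine ⟨measurable_socialSurplus.aestronglyMeasurable, ?_⟩
    rw [HasFiniteIntegral, lintegral_dirac' _ measurable_socialSurplus.enorm]
    exact enorm_lt_top

theorem CostDistribution.welfare_dirac (c : CostFunction σ) :
    (CostDistribution.dirac c).welfare = socialSurplus c :=
  integral_dirac' _ _ measurable_socialSurplus.stronglyMeasurable

theorem CostDistribution.surplus_dirac (c : CostFunction σ) (t : Mechanism σ) :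
    (CostDistribution.dirac c).surplus t = (buyerSurplus c t : EReal) := by
  have hm := measurable_buyerSurplus t
  simp only [CostDistribution.surplus, extIntegral, CostDistribution.dirac, ← EReal.coe_neg,
    EReal.real_coe_toENNReal]
  have hn : Measurable fun c : CostFunction σ => ENNReal.ofReal (-buyerSurplus c t) :=
    hm.neg.ennreal_ofReal
  rw [lintegral_dirac' _ hm.ennreal_ofReal, lintegral_dirac' _ hn,
    EReal.coe_ennreal_ofReal, EReal.coe_ennreal_ofReal, ← EReal.coe_sub,
    max_zero_sub_max_neg_zero_eq_self]

theorem ratio_dirac (F : ProbabilityMeasure (Mechanism σ)) (c : CostFunction σ) :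
    ratio F (CostDistribution.dirac c) = ratioAtCost F c := by
  simp only [ratio, ratioAtCost, CostDistribution.surplus_dirac, CostDistribution.welfare_dirac]

theorem measurable_buyerSurplus_right (c : CostFunction σ) :
    Measurable fun t : Mechanism σ => buyerSurplus c t := by
  have h := measurable_ereal_toReal.comp (measurable_surplus (CostDistribution.dirac c))
  simpa only [Function.comp_def, CostDistribution.surplus_dirac, EReal.toReal_coe] using h

/-- Any positive share induces a positive quantity, because the marginal utility at zero is infinite
while a convex cost function has finite slope near zero. -/
theorem supply_constantShare_pos (hσ : σ ∈ Ioo (0 : ℝ) 1) (c : CostFunction σ) {z : ℝ}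
    (hz : 0 < z) : 0 < supply c (constantShare hσ z) := by
  refine lt_of_le_of_ne (supply_nonneg _ _) fun h0 => ?_
  have hσ0 := hσ.1
  have hσ1 : 0 < 1 - σ := by linarith [hσ.2]
  have hc1 : 0 ≤ c.1 1 := c.2.nonneg zero_le_one
  -- at `x = y ^ (-1 / (1 - σ))` the average utility `x ^ (σ - 1)` equals `y`
  set y : ℝ := σ * c.1 1 / z + 1 with hy
  have hy1 : 1 ≤ y := by rw [hy]; linarith [show 0 ≤ σ * c.1 1 / z by positivity]
  have hy0 : 0 < y := by linarith
  set x : ℝ := y ^ (-(1 / (1 - σ))) with hx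
  have hx0 : 0 < x := Real.rpow_pos_of_pos hy0 _
  have hx1 : x ≤ 1 := Real.rpow_le_one_of_one_le_of_nonpos hy1 (by
    rw [neg_nonpos]; positivity)
  have hxs : x ^ σ = y * x := by
    have : x ^ (σ - 1) = y := by
      rw [hx, ← Real.rpow_mul hy0.le]
      have : -(1 / (1 - σ)) * (σ - 1) = 1 := by field_simp; ring
      rw [this, Real.rpow_one]
    rw [← this, ← Real.rpow_add_one hx0.ne', sub_add_cancel]
  have h1 := supply_optimal c (constantShare hσ z) hx0.le
  rw [← h0] at h1
  simp only [constantShare, grossUtility_zero hσ, c.2.zero, mul_zero, sub_zero] at h1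
  have h2 := c.2.le_chord hx0.le hx1 one_pos
  rw [grossUtility, hxs, hy] at h1
  have h3 : z * ((σ * c.1 1 / z + 1) * x / σ) = x * c.1 1 + z / σ * x := by
    field_simp
  rw [h3] at h1
  have h4 : 0 < z / σ * x := by positivity
  linarith

theorem socialSurplus_pos (hσ : σ ∈ Ioo (0 : ℝ) 1) (c : CostFunction σ) :
    0 < socialSurplus c := by
  have h1 := supply_constantShare_pos hσ c hσ.1
  have h2 := le_socialSurplus hσ c h1.le
  have h3 := profit_nonneg c (constantShare hσ σ)
  have h4 : 0 < grossUtility σ (supply c (constantShare hσ σ)) :=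
    div_pos (Real.rpow_pos_of_pos h1 _) hσ.1
  simp only [constantShare] at h3
  simp only [constantShare] at h2 h4
  nlinarith [hσ.2]

theorem CostDistribution.welfare_pos (hσ : σ ∈ Ioo (0 : ℝ) 1) (G : CostDistribution σ) :
    0 < G.welfare := by
  have := G.prob
  rw [CostDistribution.welfare, integral_pos_iff_support_of_nonneg
    (fun c => socialSurplus_nonneg hσ c) G.finite_welfare]
  have : Function.support (socialSurplus (σ := σ)) = univ := by
    ext c; simp [(socialSurplus_pos hσ c).ne']
  rw [this]
  simp

/-- Randomizing over mechanisms does no better than the best mechanism. -/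
theorem ratio_le_iSup (hσ : σ ∈ Ioo (0 : ℝ) 1) (F : ProbabilityMeasure (Mechanism σ))
    (G : CostDistribution σ) : ratio F G ≤ ⨆ t : Mechanism σ, ratioAtMechanism G t := by
  have hw : (0 : EReal) < ((G.welfare : ℝ) : EReal) := by exact_mod_cast G.welfare_pos hσ
  have hw' : ((G.welfare : ℝ) : EReal) ≠ ⊤ := EReal.coe_ne_top _
  refine le_of_forall_gt_imp_ge_of_dense fun y hy => ?_
  obtain ⟨x, hx1, hx2⟩ := EReal.lt_iff_exists_real_btwn.1 hy
  refine le_trans ?_ hx2.le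
  rw [ratio, EReal.div_le_iff_le_mul hw hw']
  rw [← EReal.coe_mul, ← extIntegral_const (μ := (F : Measure (Mechanism σ)))]
  refine extIntegral_mono_ae (ae_of_all _ fun t => ?_)
  rw [EReal.coe_mul, ← EReal.div_le_iff_le_mul hw hw']
  exact (le_iSup (fun t => ratioAtMechanism G t) t).trans hx1.le

end Surplus

/-! ### Constant share mechanisms against an arbitrary cost function -/

section Share

variable {σ : ℝ}

/-- The quantity supplied increases with the seller's share. -/
theorem monotone_supply_constantShare (hσ : σ ∈ Ioo (0 : ℝ) 1) (c : CostFunction σ) :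
    Monotone fun z => supply c (constantShare hσ z) := by
  intro z z' hz
  by_contra! hlt
  have h0 := supply_nonneg c (constantShare hσ z')
  have h1 := lt_of_lt_supply c (constantShare hσ z) h0 hlt
  have h2 := supply_optimal c (constantShare hσ z') (supply_nonneg c (constantShare hσ z))
  have h3 := grossUtility_mono hσ h0 hlt.le
  simp only [constantShare] at h1 h2 h3
  nlinarith

/-- The buyer's gross utility when the seller receives the share `z`. -/
noncomputable def shareUtility (hσ : σ ∈ Ioo (0 : ℝ) 1) (c : CostFunction σ) (z : ℝ) : ℝ :=
  grossUtility σ (supply c (constantShare hσ z))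

theorem shareUtility_nonneg (hσ : σ ∈ Ioo (0 : ℝ) 1) (c : CostFunction σ) (z : ℝ) :
    0 ≤ shareUtility hσ c z :=
  grossUtility_nonneg hσ (supply_nonneg _ _)

theorem monotone_shareUtility (hσ : σ ∈ Ioo (0 : ℝ) 1) (c : CostFunction σ) :
    Monotone (shareUtility hσ c) := fun _ _ h =>
  grossUtility_mono hσ (supply_nonneg _ _) (monotone_supply_constantShare hσ c h)

theorem buyerSurplus_constantShare (hσ : σ ∈ Ioo (0 : ℝ) 1) (c : CostFunction σ) (z : ℝ) :
    buyerSurplus c (constantShare hσ z) = (1 - z) * shareUtility hσ c z := by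
  simp only [buyerSurplus, constantShare, shareUtility]
  ring

theorem measurable_shareUtility (hσ : σ ∈ Ioo (0 : ℝ) 1) {z : ℝ} (hz : z < 1) :
    Measurable fun c => shareUtility hσ c z := by
  have h := (measurable_buyerSurplus (constantShare hσ z)).const_mul (1 - z)⁻¹
  simpa only [buyerSurplus_constantShare, inv_mul_cancel_left₀ (sub_pos.2 hz).ne'] using h

/-- The expected gross utility when the seller receives the share `z`. -/
noncomputable def expectedUtility (hσ : σ ∈ Ioo (0 : ℝ) 1) (G : CostDistribution σ) (z : ℝ) :
    ENNReal :=
  ∫⁻ c, ENNReal.ofReal (shareUtility hσ c z) ∂G.measure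

theorem monotone_expectedUtility (hσ : σ ∈ Ioo (0 : ℝ) 1) (G : CostDistribution σ) :
    Monotone (expectedUtility hσ G) := fun _ _ h =>
  lintegral_mono fun c => ENNReal.ofReal_le_ofReal (monotone_shareUtility hσ c h)

theorem lintegral_buyerSurplus_constantShare (hσ : σ ∈ Ioo (0 : ℝ) 1) (G : CostDistribution σ)
    {z : ℝ} (hz : z ≤ 1) :
    ∫⁻ c, ENNReal.ofReal (buyerSurplus c (constantShare hσ z)) ∂G.measure =
      ENNReal.ofReal (1 - z) * expectedUtility hσ G z := by
  rw [expectedUtility, ← lintegral_const_mul' _ _ ENNReal.ofReal_ne_top]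
  refine lintegral_congr fun c => ?_
  rw [buyerSurplus_constantShare, ENNReal.ofReal_mul (by linarith)]

theorem surplus_constantShare (hσ : σ ∈ Ioo (0 : ℝ) 1) (G : CostDistribution σ) {z : ℝ}
    (hz : z ≤ 1) : G.surplus (constantShare hσ z) =
      ((ENNReal.ofReal (1 - z) * expectedUtility hσ G z : ENNReal) : EReal) := by
  rw [CostDistribution.surplus, extIntegral_of_nonneg (ae_of_all _ fun c => ?_),
    ← lintegral_buyerSurplus_constantShare hσ G hz]
  · simp only [EReal.real_coe_toENNReal]
  · rw [buyerSurplus_constantShare]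
    exact_mod_cast mul_nonneg (by linarith) (shareUtility_nonneg hσ c z)

theorem surplus_constantShare_of_one_le (hσ : σ ∈ Ioo (0 : ℝ) 1) (G : CostDistribution σ) {z : ℝ}
    (hz : 1 ≤ z) : G.surplus (constantShare hσ z) =
      -((ENNReal.ofReal (z - 1) * expectedUtility hσ G z : ENNReal) : EReal) := by
  have h : ∀ c, buyerSurplus c (constantShare hσ z) ≤ 0 := fun c => by
    rw [buyerSurplus_constantShare]
    exact mul_nonpos_of_nonpos_of_nonneg (by linarith) (shareUtility_nonneg hσ c z)
  simp only [CostDistribution.surplus, extIntegral, ← EReal.coe_neg, EReal.real_coe_toENNReal]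
  simp only [ENNReal.ofReal_of_nonpos (h _), lintegral_zero, EReal.coe_ennreal_zero, zero_sub]
  rw [expectedUtility, ← lintegral_const_mul' _ _ ENNReal.ofReal_ne_top]
  congr 2
  refine lintegral_congr fun c => ?_
  rw [buyerSurplus_constantShare, ← ENNReal.ofReal_mul (by linarith)]
  congr 1
  ring

theorem measurable_constantShare (hσ : σ ∈ Ioo (0 : ℝ) 1) : Measurable (constantShare hσ) := by
  refine measurable_to_mechanism fun G => ?_
  have hH := (monotone_expectedUtility hσ G).measurable
  have h : (fun z => G.surplus (constantShare hσ z)) = fun z =>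
      if z ≤ 1 then ((ENNReal.ofReal (1 - z) * expectedUtility hσ G z : ENNReal) : EReal)
      else -((ENNReal.ofReal (z - 1) * expectedUtility hσ G z : ENNReal) : EReal) := by
    ext z
    split_ifs with hz
    · rw [surplus_constantShare hσ G hz]
    · rw [surplus_constantShare_of_one_le hσ G (not_le.1 hz).le]
  rw [h]
  refine Measurable.ite measurableSet_Iic ?_ ?_
  · exact Measurable.coe_ereal_ennreal (by fun_prop)
  · exact (Measurable.coe_ereal_ennreal (by fun_prop)).neg

/-! ### Linear bounds on the social surplus -/

/-- The largest value of gross utility minus expenditure at the price `p`. -/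
noncomputable def indirectUtility (σ p : ℝ) : ℝ := (1 - σ) / σ * p ^ (-(σ / (1 - σ)))

theorem grossUtility_sub_le (hσ : σ ∈ Ioo (0 : ℝ) 1) {p q : ℝ} (hp : 0 < p) (hq : 0 ≤ q) :
    grossUtility σ q - p * q ≤ indirectUtility σ p := by
  have hσ0 := hσ.1
  have hσ1 : 0 < 1 - σ := by linarith [hσ.2]
  -- in units of the optimal quantity `p ^ (-1 / (1 - σ))` this is the weighted AM-GM inequality
  set r := p ^ (-(1 / (1 - σ))) with hr
  have hr0 : 0 < r := Real.rpow_pos_of_pos hp _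
  have hrs : r ^ σ = p ^ (-(σ / (1 - σ))) := by
    rw [hr, ← Real.rpow_mul hp.le]; congr 1; ring
  have hpr : p * r = r ^ σ := by
    rw [hrs, hr]
    nth_rewrite 1 [← Real.rpow_one p]
    rw [← Real.rpow_add hp]; congr 1; field_simp; ring
  obtain ⟨y, hy, rfl⟩ : ∃ y, 0 ≤ y ∧ q = y * r := ⟨q / r, by positivity, by field_simp⟩
  have ham := Real.geom_mean_le_arith_mean2_weighted hσ0.le hσ1.le hy zero_le_one (by ring)
  rw [Real.one_rpow, mul_one, mul_one] at ham
  have hrσ : 0 < r ^ σ := Real.rpow_pos_of_pos hr0 _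
  rw [grossUtility, indirectUtility, ← hrs, Real.mul_rpow hy hr0.le,
    show p * (y * r) = y * (p * r) by ring, hpr, div_mul_eq_mul_div,
    sub_le_iff_le_add, div_add' _ _ _ hσ0.ne', div_le_div_iff_of_pos_right hσ0]
  nlinarith

theorem grossUtility_sub_eq (hσ : σ ∈ Ioo (0 : ℝ) 1) {p : ℝ} (hp : 0 < p) :
    grossUtility σ (p ^ (-(1 / (1 - σ)))) - p * p ^ (-(1 / (1 - σ))) = indirectUtility σ p := by
  have hσ0 := hσ.1
  have hσ1 : 0 < 1 - σ := by linarith [hσ.2]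
  have hpr : p * p ^ (-(1 / (1 - σ))) = p ^ (-(σ / (1 - σ))) := by
    nth_rewrite 1 [← Real.rpow_one p]
    rw [← Real.rpow_add hp]; congr 1; field_simp; ring
  have hrs : (p ^ (-(1 / (1 - σ)))) ^ σ = p ^ (-(σ / (1 - σ))) := by
    rw [← Real.rpow_mul hp.le]; congr 1; ring
  rw [grossUtility, indirectUtility, hpr, hrs]
  field_simp

theorem socialSurplus_le_of_line (hσ : σ ∈ Ioo (0 : ℝ) 1) (c : CostFunction σ) {p y : ℝ}
    (hp : 0 < p) (h : ∀ q, 0 ≤ q → y + p * q ≤ c.1 q) :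
    socialSurplus c ≤ indirectUtility σ p - y :=
  socialSurplus_le hσ c fun q hq => by
    linarith [h q hq, grossUtility_sub_le hσ hp hq]

theorem socialSurplus_eq_of_line (hσ : σ ∈ Ioo (0 : ℝ) 1) (c : CostFunction σ) {p y : ℝ}
    (hp : 0 < p) (h : ∀ q, 0 ≤ q → y + p * q ≤ c.1 q)
    (h' : c.1 (p ^ (-(1 / (1 - σ)))) = y + p * p ^ (-(1 / (1 - σ)))) :
    socialSurplus c = indirectUtility σ p - y := by
  refine le_antisymm (socialSurplus_le_of_line hσ c hp h) ?_
  have h1 := le_socialSurplus hσ c (Real.rpow_nonneg hp.le (-(1 / (1 - σ))))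
  linarith [grossUtility_sub_eq hσ hp]

theorem hasDerivAt_grossUtility (hσ : σ ∈ Ioo (0 : ℝ) 1) {q : ℝ} (hq : 0 < q) :
    HasDerivAt (grossUtility σ) (q ^ (σ - 1)) q := by
  have h := (Real.hasDerivAt_rpow_const (p := σ) (Or.inl hq.ne')).div_const σ
  rwa [mul_div_cancel_left₀ _ hσ.1.ne'] at h

/-- The seller's first-order condition: at the quantity supplied under the share `z`, the line with
slope `z u'` supports the cost function from below. -/
theorem tangent_le_cost (hσ : σ ∈ Ioo (0 : ℝ) 1) (c : CostFunction σ) {z x : ℝ} (hz : 0 < z)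
    (hx : 0 ≤ x) : c.1 (supply c (constantShare hσ z)) +
      z * supply c (constantShare hσ z) ^ (σ - 1) * (x - supply c (constantShare hσ z)) ≤ c.1 x := by
  have hq := supply_constantShare_pos hσ c hz
  have hopt := fun {y : ℝ} (hy : 0 ≤ y) => supply_optimal c (constantShare hσ z) hy
  set q := supply c (constantShare hσ z) with hqdef
  simp only [constantShare] at hopt
  have hin : HasDerivAt (fun s : ℝ => q + s * (x - q)) (x - q) 0 := by
    simpa using ((hasDerivAt_id (0 : ℝ)).mul_const (x - q)).const_add q
  have hu : HasDerivAt (fun s : ℝ => grossUtility σ (q + s * (x - q)))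
      (q ^ (σ - 1) * (x - q)) 0 := by
    have h := hasDerivAt_grossUtility hσ hq
    have h0 : q = q + 0 * (x - q) := by ring
    rw [h0] at h
    have h2 := HasDerivAt.comp (0 : ℝ) h hin
    rw [← h0] at h2
    exact h2
  have hs := (hasDerivAt_iff_tendsto_slope.1 hu).mono_left
    (nhdsWithin_mono 0 (fun s (hs : s ∈ Ioi (0 : ℝ)) => (mem_Ioi.1 hs).ne'))
  have hle : z * (q ^ (σ - 1) * (x - q)) ≤ c.1 x - c.1 q := by
    refine le_of_tendsto (hs.const_mul z) ?_
    filter_upwards [Ioo_mem_nhdsGT (zero_lt_one' ℝ)] with s hs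
    have hy : 0 ≤ q + s * (x - q) := by nlinarith [hs.1, hs.2]
    have h1 := hopt hy
    have h2 := c.2.convex.2 (mem_Ici.2 hq.le) (mem_Ici.2 hx) (by linarith [hs.2] : 0 ≤ 1 - s)
      hs.1.le (by ring)
    simp only [smul_eq_mul] at h2
    rw [show (1 - s) * q + s * x = q + s * (x - q) by ring] at h2
    rw [slope_def_field, sub_zero, zero_mul, add_zero, ← mul_div_assoc, div_le_iff₀ hs.1]
    linarith
  linarith

/-- The social surplus is at most the seller's profit under the share `σ` plus a multiple of the
gross utility generated by that share, with equality for a linear cost function. -/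
theorem socialSurplus_le_share (hσ : σ ∈ Ioo (0 : ℝ) 1) (c : CostFunction σ) :
    socialSurplus c ≤ (σ * shareUtility hσ c σ - c.1 (supply c (constantShare hσ σ))) +
      (1 - σ) * (σ ^ (-σ / (1 - σ)) - σ) * shareUtility hσ c σ := by
  have hσ0 := hσ.1
  have hσ1 : 0 < 1 - σ := by linarith [hσ.2]
  have hq := supply_constantShare_pos hσ c hσ0
  have ht := fun {x : ℝ} (hx : 0 ≤ x) => tangent_le_cost hσ c (z := σ) hσ0 hx
  unfold shareUtility
  set q := supply c (constantShare hσ σ) with hqdef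
  have hp : 0 < σ * q ^ (σ - 1) := mul_pos hσ0 (Real.rpow_pos_of_pos hq _)
  have h := socialSurplus_le_of_line hσ c hp (y := c.1 q - σ * q ^ (σ - 1) * q)
    (fun x hx => by linarith [ht hx])
  have h1 : q ^ (σ - 1) * q = q ^ σ := by
    rw [← Real.rpow_add_one hq.ne', sub_add_cancel]
  have h2 : indirectUtility σ (σ * q ^ (σ - 1)) =
      (1 - σ) / σ * (σ ^ (-σ / (1 - σ)) * q ^ σ) := by
    rw [indirectUtility, Real.mul_rpow hσ0.le (Real.rpow_nonneg hq.le _), ← Real.rpow_mul hq.le]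
    congr 4
    · ring
    · field_simp; ring
  rw [h2, mul_assoc σ, h1] at h
  refine h.trans (le_of_eq ?_)
  rw [grossUtility]
  field_simp
  ring

/-- The envelope formula in discrete form: the profit under the share `s` is at most an upper
Riemann sum of the gross utilities under smaller shares. -/
theorem profit_le_sum_shareUtility (hσ : σ ∈ Ioo (0 : ℝ) 1) (c : CostFunction σ) (s : ℝ) (n : ℕ)
    (hn : n ≠ 0) : s * shareUtility hσ c s - c.1 (supply c (constantShare hσ s)) ≤
      ∑ i ∈ Finset.range n, s / n * shareUtility hσ c (s / n * (i + 1 : ℕ)) := by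
  have hn' : (n : ℝ) ≠ 0 := by exact_mod_cast hn
  set P : ℕ → ℝ := fun i => s / n * i * shareUtility hσ c (s / n * i) -
    c.1 (supply c (constantShare hσ (s / n * i))) with hP
  have h0 : P 0 ≤ 0 := by
    have h := c.2.nonneg (supply_nonneg c (constantShare hσ (s / n * (0 : ℕ))))
    simp only [hP, Nat.cast_zero, mul_zero, zero_mul, zero_sub, neg_nonpos]
    simpa using h
  have hPn : P n = s * shareUtility hσ c s - c.1 (supply c (constantShare hσ s)) := by
    simp only [hP, div_mul_cancel₀ _ hn']
  rw [← hPn]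
  have hstep : ∀ i ∈ Finset.range n, P (i + 1) - P i ≤
      s / n * shareUtility hσ c (s / n * (i + 1 : ℕ)) := by
    intro i _
    have h := supply_optimal c (constantShare hσ (s / n * i))
      (supply_nonneg c (constantShare hσ (s / n * (i + 1 : ℕ))))
    simp only [hP, shareUtility, constantShare] at h ⊢
    push_cast at h ⊢
    linarith
  have h := Finset.sum_le_sum hstep
  rw [Finset.sum_range_sub] at h
  linarith

/-- Lower Riemann sums of an increasing function are at most its integral. -/
theorem sum_le_lintegral_of_monotone {H : ℝ → ENNReal} (hH : Monotone H) {h : ℝ} (hh : 0 < h)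
    (n : ℕ) : ∑ i ∈ Finset.range n, ENNReal.ofReal h * H (h * i) ≤
      ∫⁻ z in Ico 0 (h * n), H z := by
  induction n with
  | zero => simp
  | succ n ih =>
    have hsplit : Ico 0 (h * (n + 1 : ℕ)) = Ico 0 (h * n) ∪ Ico (h * n) (h * (n + 1 : ℕ)) := by
      rw [Ico_union_Ico_eq_Ico (by positivity)]
      push_cast
      nlinarith
    have hdisj : Disjoint (Ico 0 (h * n)) (Ico (h * n) (h * (n + 1 : ℕ))) :=
      Ico_disjoint_Ico_same
    rw [Finset.sum_range_succ, hsplit, lintegral_union measurableSet_Ico hdisj]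
    refine add_le_add ih ?_
    calc ENNReal.ofReal h * H (h * n)
        = ∫⁻ _ in Ico (h * n) (h * (n + 1 : ℕ)), H (h * n) := by
          rw [setLIntegral_const, Real.volume_Ico, mul_comm]
          congr 2
          push_cast
          ring
      _ ≤ _ := setLIntegral_mono' measurableSet_Ico fun z hz => hH hz.1

/-! ### The random share -/

theorem saddleValue_denom_pos (hσ : σ ∈ Ioo (0 : ℝ) 1) :
    0 < σ ^ (-σ / (1 - σ)) - σ ∧ 0 < σ ^ (-σ / (1 - σ)) - σ - Real.log (1 - σ) := by
  have hσ0 := hσ.1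
  have hσ1 : 0 < 1 - σ := by linarith [hσ.2]
  have h1 : 1 < σ ^ (-σ / (1 - σ)) := by
    refine Real.one_lt_rpow_of_pos_of_lt_one_of_neg hσ0 hσ.2 ?_
    rw [neg_div, neg_lt_zero]
    positivity
  have h2 : Real.log (1 - σ) < 0 := Real.log_neg hσ1 (by linarith)
  constructor <;> linarith [hσ.2]

theorem saddleValue_pos (hσ : σ ∈ Ioo (0 : ℝ) 1) : 0 < saddleValue σ :=
  one_div_pos.2 (saddleValue_denom_pos hσ).2

theorem shareLaw_atom_eq (hσ : σ ∈ Ioo (0 : ℝ) 1) : 1 + saddleValue σ * Real.log (1 - σ) =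
    saddleValue σ * (σ ^ (-σ / (1 - σ)) - σ) := by
  have h := (saddleValue_denom_pos hσ).2
  have h1 : saddleValue σ * (σ ^ (-σ / (1 - σ)) - σ - Real.log (1 - σ)) = 1 :=
    one_div_mul_cancel h.ne'
  linarith

theorem lintegral_shareLaw (hσ : σ ∈ Ioo (0 : ℝ) 1) (f : ℝ → ENNReal) :
    ∫⁻ z, f z ∂shareLaw σ =
      (∫⁻ z in Ioo 0 σ, ENNReal.ofReal (saddleValue σ / (1 - z)) * f z) +
        ENNReal.ofReal (saddleValue σ * (σ ^ (-σ / (1 - σ)) - σ)) * f σ := by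
  rw [shareLaw, lintegral_add_measure, lintegral_smul_measure, lintegral_dirac, shareLaw_atom_eq hσ,
    lintegral_withDensity_eq_lintegral_mul_non_measurable₀]
  · rfl
  · exact Measurable.aemeasurable (by fun_prop)
  · exact ae_of_all _ fun z => ENNReal.ofReal_lt_top

theorem lintegral_shareLaw_one_sub_mul (hσ : σ ∈ Ioo (0 : ℝ) 1) (H : ℝ → ENNReal) :
    ∫⁻ z, ENNReal.ofReal (1 - z) * H z ∂shareLaw σ = ENNReal.ofReal (saddleValue σ) *
      ((∫⁻ z in Ioo 0 σ, H z) +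
        ENNReal.ofReal ((1 - σ) * (σ ^ (-σ / (1 - σ)) - σ)) * H σ) := by
  have hB := saddleValue_pos hσ
  have hd := (saddleValue_denom_pos hσ).1
  have hσ1 : 0 < 1 - σ := by linarith [hσ.2]
  rw [lintegral_shareLaw hσ, mul_add, ← lintegral_const_mul' _ _ ENNReal.ofReal_ne_top]
  congr 1
  · refine setLIntegral_congr_fun measurableSet_Ioo fun z hz => ?_
    have hz1 : 0 < 1 - z := by linarith [hz.2, hσ.2]
    rw [← mul_assoc, ← ENNReal.ofReal_mul (by positivity), div_mul_cancel₀ _ hz1.ne']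
  · rw [← mul_assoc, ← mul_assoc, ← ENNReal.ofReal_mul (by positivity),
      ← ENNReal.ofReal_mul (by positivity)]
    congr 2
    ring

theorem isProbabilityMeasure_shareLaw (hσ : σ ∈ Ioo (0 : ℝ) 1) :
    IsProbabilityMeasure (shareLaw σ) := by
  have hB := saddleValue_pos hσ
  have hd := (saddleValue_denom_pos hσ).1
  have hσ1 : 0 < 1 - σ := by linarith [hσ.2]
  have hder : ∀ z ∈ uIcc 0 σ, HasDerivAt (fun z => -saddleValue σ * Real.log (1 - z))
      (saddleValue σ / (1 - z)) z := by
    intro z hz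
    rw [uIcc_of_le hσ.1.le] at hz
    have hz1 : 1 - z ≠ 0 := by linarith [hz.2, hσ.2]
    refine ((((hasDerivAt_id z).const_sub 1).log hz1).const_mul (-saddleValue σ)).congr_deriv ?_
    simp only [id]
    field_simp
  have hcont : ContinuousOn (fun z => saddleValue σ / (1 - z)) (uIcc 0 σ) := by
    rw [uIcc_of_le hσ.1.le]
    refine continuousOn_const.div (by fun_prop) fun z hz => ?_
    linarith [hz.2, hσ.2]
  have hint := intervalIntegral.integral_eq_sub_of_hasDerivAt hder hcont.intervalIntegrable
  have hlin : ∫⁻ z in Ioo 0 σ, ENNReal.ofReal (saddleValue σ / (1 - z)) =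
      ENNReal.ofReal (-saddleValue σ * Real.log (1 - σ)) := by
    rw [setLIntegral_congr Ioo_ae_eq_Ioc, ← ofReal_integral_eq_lintegral_ofReal,
      ← intervalIntegral.integral_of_le hσ.1.le, hint]
    · simp
    · exact (intervalIntegrable_iff_integrableOn_Ioc_of_le hσ.1.le).1 hcont.intervalIntegrable
    · filter_upwards [ae_restrict_mem measurableSet_Ioc] with z hz
      exact div_nonneg hB.le (by linarith [hz.2, hσ.2])
  have hlog : Real.log (1 - σ) < 0 := Real.log_neg hσ1 (by linarith [hσ.1])
  constructor
  rw [← lintegral_one, lintegral_shareLaw hσ]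
  simp only [mul_one]
  rw [hlin, ← ENNReal.ofReal_add (by nlinarith) (by positivity), ← shareLaw_atom_eq hσ]
  simp

theorem ae_shareLaw_mem (hσ : σ ∈ Ioo (0 : ℝ) 1) : ∀ᵐ z ∂shareLaw σ, z ∈ Ioc 0 σ := by
  rw [shareLaw, ae_add_measure_iff]
  constructor
  · refine (withDensity_absolutelyContinuous _ _).ae_le ?_
    filter_upwards [ae_restrict_mem measurableSet_Ioo] with z hz using ⟨hz.1, hz.2.le⟩
  · refine Measure.ae_smul_measure ?_ _
    exact (ae_dirac_iff (p := fun z => z ∈ Ioc 0 σ) measurableSet_Ioc).2 ⟨hσ.1, le_rfl⟩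

/-- The law of the constant share mechanism with a random share. -/
noncomputable def shareMechanismLaw (hσ : σ ∈ Ioo (0 : ℝ) 1) :
    ProbabilityMeasure (Mechanism σ) :=
  ⟨(shareLaw σ).map (constantShare hσ),
    have := isProbabilityMeasure_shareLaw hσ
    Measure.isProbabilityMeasure_map (measurable_constantShare hσ).aemeasurable⟩

theorem extIntegral_shareMechanismLaw (hσ : σ ∈ Ioo (0 : ℝ) 1) (G : CostDistribution σ) :
    extIntegral (shareMechanismLaw hσ : Measure (Mechanism σ)) (fun t => G.surplus t) =
      ((ENNReal.ofReal (saddleValue σ) * ((∫⁻ z in Ioo 0 σ, expectedUtility hσ G z) +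
        ENNReal.ofReal ((1 - σ) * (σ ^ (-σ / (1 - σ)) - σ)) * expectedUtility hσ G σ) :
          ENNReal) : EReal) := by
  have hm := measurable_constantShare hσ
  have hs := measurable_surplus G
  have hs' : Measurable fun t => (G.surplus t).toENNReal := hs.ereal_toENNReal
  have hval : ∀ᵐ z ∂shareLaw σ, G.surplus (constantShare hσ z) =
      ((ENNReal.ofReal (1 - z) * expectedUtility hσ G z : ENNReal) : EReal) := by
    filter_upwards [ae_shareLaw_mem hσ] with z hz
    exact surplus_constantShare hσ G (hz.2.trans hσ.2.le)
  have hμ : (shareMechanismLaw hσ : Measure (Mechanism σ)) =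
    (shareLaw σ).map (constantShare hσ) := rfl
  rw [hμ, extIntegral_of_nonneg]
  · rw [lintegral_map hs' hm, ← lintegral_shareLaw_one_sub_mul hσ]
    congr 1
    refine lintegral_congr_ae ?_
    filter_upwards [hval] with z hz
    rw [hz, EReal.toENNReal_coe]
  · rw [ae_map_iff hm.aemeasurable (measurableSet_le measurable_const hs)]
    filter_upwards [hval] with z hz
    rw [hz]
    exact EReal.coe_ennreal_nonneg _

theorem expectedUtility_ne_top (hσ : σ ∈ Ioo (0 : ℝ) 1) (G : CostDistribution σ) :
    expectedUtility hσ G σ ≠ ⊤ := by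
  have hσ1 : 0 < 1 - σ := by linarith [hσ.2]
  have h := lintegral_buyerSurplus_constantShare hσ G hσ.2.le
  intro htop
  rw [htop, ENNReal.mul_top (by simpa using hσ.2)] at h
  have h2 : ∫⁻ c, ENNReal.ofReal (socialSurplus c) ∂G.measure ≠ ⊤ := by
    rw [← ofReal_integral_eq_lintegral_ofReal G.finite_welfare
      (ae_of_all _ fun c => socialSurplus_nonneg hσ c)]
    exact ENNReal.ofReal_ne_top
  refine h2 (top_le_iff.1 (h ▸ lintegral_mono fun c => ENNReal.ofReal_le_ofReal ?_))
  exact buyerSurplus_le_socialSurplus hσ c _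

/-- The expected social surplus is controlled by the expected gross utilities under shares in
`(0, σ]`. Passing to the limit in Riemann sums after integrating over costs avoids any joint
measurability in the share and the cost function. -/
theorem welfare_le_expectedUtility (hσ : σ ∈ Ioo (0 : ℝ) 1) (G : CostDistribution σ) :
    ENNReal.ofReal G.welfare ≤ (∫⁻ z in Ioo 0 σ, expectedUtility hσ G z) +
      ENNReal.ofReal ((1 - σ) * (σ ^ (-σ / (1 - σ)) - σ)) * expectedUtility hσ G σ := by
  have hσ0 := hσ.1
  have hσ1 : 0 < 1 - σ := by linarith [hσ.2]
  have hd := (saddleValue_denom_pos hσ).1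
  set b := (1 - σ) * (σ ^ (-σ / (1 - σ)) - σ) with hb
  have hb0 : 0 < b := mul_pos hσ1 hd
  set H := expectedUtility hσ G with hH
  have hbound : ∀ n : ℕ, ENNReal.ofReal G.welfare ≤
      ((∫⁻ z in Ioo 0 σ, H z) + ENNReal.ofReal b * H σ) +
        ENNReal.ofReal (σ / (n + 1 : ℕ)) * H σ := by
    intro m
    set n := m + 1 with hn
    have hn0 : n ≠ 0 := by omega
    have hn1 : (0 : ℝ) < n := by exact_mod_cast Nat.pos_of_ne_zero hn0
    set h := σ / n with hh
    have hh0 : 0 < h := by positivity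
    have hhn : h * n = σ := div_mul_cancel₀ _ hn1.ne'
    have hle1 : ∀ i ∈ Finset.range n, h * (i + 1 : ℕ) < 1 := by
      intro i hi
      have : ((i + 1 : ℕ) : ℝ) ≤ n := by exact_mod_cast Finset.mem_range.1 hi
      nlinarith [hσ.2]
    have hpt : ∀ c : CostFunction σ, ENNReal.ofReal (socialSurplus c) ≤
        ∑ i ∈ Finset.range n, ENNReal.ofReal h *
          ENNReal.ofReal (shareUtility hσ c (h * (i + 1 : ℕ))) +
        ENNReal.ofReal b * ENNReal.ofReal (shareUtility hσ c σ) := by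
      intro c
      have h1 := (socialSurplus_le_share hσ c).trans
        (add_le_add_left (profit_le_sum_shareUtility hσ c σ n hn0) _)
      refine (ENNReal.ofReal_le_ofReal h1).trans (le_of_eq ?_)
      have hs : ∀ i ∈ Finset.range n, 0 ≤ h * shareUtility hσ c (h * (i + 1 : ℕ)) :=
        fun i _ => mul_nonneg hh0.le (shareUtility_nonneg hσ c _)
      rw [ENNReal.ofReal_add (Finset.sum_nonneg hs)
        (mul_nonneg hb0.le (shareUtility_nonneg hσ c _)), ENNReal.ofReal_sum_of_nonneg hs,
        ENNReal.ofReal_mul hb0.le]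
      simp only [ENNReal.ofReal_mul hh0.le]
    have hint := lintegral_mono (μ := G.measure) hpt
    rw [lintegral_add_right _ ((measurable_shareUtility hσ hσ.2).ennreal_ofReal.const_mul _),
      lintegral_finsetSum _ (fun i hi =>
        (measurable_shareUtility hσ (hle1 i hi)).ennreal_ofReal.const_mul _),
      lintegral_const_mul' _ _ ENNReal.ofReal_ne_top] at hint
    simp only [lintegral_const_mul' _ _ ENNReal.ofReal_ne_top] at hint
    rw [← ofReal_integral_eq_lintegral_ofReal G.finite_welfare
      (ae_of_all _ fun c => socialSurplus_nonneg hσ c)] at hint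
    have hsum : ∑ i ∈ Finset.range n, ENNReal.ofReal h * H (h * (i + 1 : ℕ)) ≤
        (∫⁻ z in Ioo 0 σ, H z) + ENNReal.ofReal h * H σ := by
      have h1 := Finset.sum_range_succ (fun i : ℕ => ENNReal.ofReal h * H (h * i)) n
      rw [Finset.sum_range_succ', hhn] at h1
      have h2 := sum_le_lintegral_of_monotone (monotone_expectedUtility hσ G) hh0 n
      rw [hhn, setLIntegral_congr Ioo_ae_eq_Ico.symm] at h2
      calc _ ≤ _ := le_self_add
        _ = _ := h1
        _ ≤ _ := add_le_add_left h2 _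
    exact hint.trans ((add_le_add_left hsum _).trans (add_right_comm _ _ _).le)
  have hlim : Tendsto (fun n : ℕ => ((∫⁻ z in Ioo 0 σ, H z) + ENNReal.ofReal b * H σ) +
      ENNReal.ofReal (σ / (n + 1 : ℕ)) * H σ) atTop
      (𝓝 (((∫⁻ z in Ioo 0 σ, H z) + ENNReal.ofReal b * H σ) + 0 * H σ)) := by
    refine tendsto_const_nhds.add (ENNReal.Tendsto.mul_const ?_
      (Or.inr (expectedUtility_ne_top hσ G)))
    rw [← ENNReal.ofReal_zero]
    refine ENNReal.tendsto_ofReal ?_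
    exact (tendsto_const_div_atTop_nhds_zero_nat σ).comp (tendsto_add_atTop_nat 1)
  rw [zero_mul, add_zero] at hlim
  exact ge_of_tendsto' hlim hbound

/-- The random constant share mechanism guarantees the fraction `saddleValue σ` of the expected
social surplus against every distribution of costs. -/
theorem saddleValue_le_ratio (hσ : σ ∈ Ioo (0 : ℝ) 1) (G : CostDistribution σ) :
    ((saddleValue σ : ℝ) : EReal) ≤ ratio (shareMechanismLaw hσ) G := by
  have hw := G.welfare_pos hσ
  have hB := saddleValue_pos hσ
  rw [ratio, EReal.le_div_iff_mul_le (by exact_mod_cast hw) (EReal.coe_ne_top _),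
    extIntegral_shareMechanismLaw, ← EReal.coe_mul]
  have h := mul_le_mul_right (welfare_le_expectedUtility hσ G) (ENNReal.ofReal (saddleValue σ))
  rw [← ENNReal.ofReal_mul hB.le] at h
  refine le_trans ?_ (EReal.coe_ennreal_le_coe_ennreal_iff.2 h)
  rw [EReal.coe_ennreal_ofReal]
  exact EReal.coe_le_coe_iff.2 (le_max_left _ _)

/-! ### The linear cost function -/

theorem isCostFunction_id : IsCostFunction (fun q => q) where
  zero := rfl
  mono := monotoneOn_id
  convex := convexOn_id (convex_Ici 0)
  nontrivial := ⟨1, zero_le_one, one_ne_zero⟩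

theorem shareUtility_id (hσ : σ ∈ Ioo (0 : ℝ) 1) {z : ℝ} (hz : 0 < z) :
    shareUtility hσ (⟨fun q => q, isCostFunction_id⟩ : CostFunction σ) z =
      z ^ (σ / (1 - σ)) / σ := by
  have hσ1 : 0 < 1 - σ := by linarith [hσ.2]
  set c : CostFunction σ := ⟨fun q => q, isCostFunction_id⟩ with hc
  have hq := supply_constantShare_pos hσ c hz
  have ht := fun {x : ℝ} (hx : 0 ≤ x) => tangent_le_cost hσ c hz hx
  rw [shareUtility]
  set q := supply c (constantShare hσ z) with hqdef
  have h1 := ht hq.le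
  have h2 := ht (show 0 ≤ q + 1 by linarith)
  have h3 := ht le_rfl
  simp only [hc] at h1 h2 h3
  have h4 : z * q ^ (σ - 1) = 1 := by
    refine le_antisymm (by linarith) ?_
    have : 0 ≤ q * (z * q ^ (σ - 1) - 1) := by linarith
    linarith [nonneg_of_mul_nonneg_right this hq]
  have h5 : z = q ^ (1 - σ) := by
    have h6 : q ^ (σ - 1) * q ^ (1 - σ) = 1 := by
      rw [← Real.rpow_add hq]; simp
    have h7 : q ^ (σ - 1) ≠ 0 := (Real.rpow_pos_of_pos hq _).ne'
    exact mul_right_cancel₀ h7 (by rw [h4, mul_comm, h6])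
  rw [grossUtility, h5, ← Real.rpow_mul hq.le, mul_div_cancel₀ _ hσ1.ne']

theorem ratio_linear_le (hσ : σ ∈ Ioo (0 : ℝ) 1) :
    ratio (shareMechanismLaw hσ)
      (CostDistribution.dirac (⟨fun q => q, isCostFunction_id⟩ : CostFunction σ)) ≤
      ((saddleValue σ : ℝ) : EReal) := by
  have hσ0 := hσ.1
  have hσ1 : 0 < 1 - σ := by linarith [hσ.2]
  have hd := (saddleValue_denom_pos hσ).1
  have hB := saddleValue_pos hσ
  set c : CostFunction σ := ⟨fun q => q, isCostFunction_id⟩ with hc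
  have ha : 0 < σ / (1 - σ) := by positivity
  have hH : ∀ z, 0 < z → z < 1 → expectedUtility hσ (CostDistribution.dirac c) z =
      ENNReal.ofReal (z ^ (σ / (1 - σ)) / σ) := by
    intro z hz hz1
    rw [expectedUtility, CostDistribution.dirac,
      lintegral_dirac' _ (measurable_shareUtility hσ hz1).ennreal_ofReal, shareUtility_id hσ hz]
  have hW : socialSurplus c = (1 - σ) / σ := by
    rw [socialSurplus_eq_of_line hσ c (y := 0) one_pos (fun q _ => by simp [hc]) (by simp [hc])]
    simp [indirectUtility]
  have hint : ∫⁻ z in Ioo 0 σ, expectedUtility hσ (CostDistribution.dirac c) z =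
      ENNReal.ofReal ((1 - σ) * σ ^ (σ / (1 - σ))) := by
    rw [setLIntegral_congr_fun measurableSet_Ioo
      (fun z hz => hH z hz.1 (hz.2.trans hσ.2)), setLIntegral_congr Ioo_ae_eq_Ioc,
      ← ofReal_integral_eq_lintegral_ofReal, ← intervalIntegral.integral_of_le hσ0.le,
      intervalIntegral.integral_div, integral_rpow (Or.inl (by linarith)),
      Real.zero_rpow (by linarith), sub_zero, Real.rpow_add_one hσ0.ne']
    · congr 1
      field_simp
      ring
    · refine (intervalIntegrable_iff_integrableOn_Ioc_of_le hσ0.le).1 ?_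
      exact (intervalIntegral.intervalIntegrable_rpow' (by linarith)).div_const σ
    · filter_upwards [ae_restrict_mem measurableSet_Ioc] with z hz
      exact div_nonneg (Real.rpow_nonneg hz.1.le _) hσ0.le
  rw [ratio, CostDistribution.welfare_dirac,
    EReal.div_le_iff_le_mul (by exact_mod_cast socialSurplus_pos hσ c) (EReal.coe_ne_top _),
    extIntegral_shareMechanismLaw, hint, hH σ hσ0 hσ.2, hW,
    ← ENNReal.ofReal_mul (by positivity), ← ENNReal.ofReal_add (by positivity) (by positivity),
    ← ENNReal.ofReal_mul hB.le, EReal.coe_ennreal_ofReal, max_eq_left (by positivity),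
    ← EReal.coe_mul]
  refine EReal.coe_le_coe_iff.2 (le_of_eq ?_)
  have hpow : σ ^ (-σ / (1 - σ)) = (σ ^ (σ / (1 - σ)))⁻¹ := by
    rw [neg_div, Real.rpow_neg hσ0.le]
  have hpos : 0 < σ ^ (σ / (1 - σ)) := Real.rpow_pos_of_pos hσ0 _
  rw [hpow]
  field_simp
  ring

end Share

/-! ### The family of critical cost functions -/

section CriticalFamily

variable {σ : ℝ}

theorem logCoeff_pos (hσ : σ ∈ Ioo (0 : ℝ) 1) {γ : ℝ} (hγ : 0 < γ) : 0 < logCoeff σ γ := by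
  rw [← lowerKink_rpow hσ hγ]
  exact Real.rpow_pos_of_pos (kinks_pos hσ hγ).1 _

theorem upperKink_anti (hσ : σ ∈ Ioo (0 : ℝ) 1) {γ γ' : ℝ} (hγ : 0 < γ) (h : γ ≤ γ') :
    upperKink σ γ' ≤ upperKink σ γ := by
  have hσ0 := hσ.1
  have hσ1 : 0 < 1 - σ := by linarith [hσ.2]
  have hγ' := hγ.trans_le h
  exact Real.rpow_le_rpow (by positivity) (div_le_div_of_nonneg_left hσ0.le hγ h) (by positivity)

theorem lowerKink_anti (hσ : σ ∈ Ioo (0 : ℝ) 1) {γ γ' : ℝ} (hγ : 0 < γ) (h : γ ≤ γ') :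
    lowerKink σ γ' ≤ lowerKink σ γ :=
  mul_le_mul_of_nonneg_left (upperKink_anti hσ hγ h)
    (Real.rpow_nonneg (by linarith [hσ.2]) _)

theorem logCoeff_anti (hσ : σ ∈ Ioo (0 : ℝ) 1) {γ γ' : ℝ} (hγ : 0 < γ) (h : γ ≤ γ') :
    logCoeff σ γ' ≤ logCoeff σ γ := by
  have hσ1 : 0 ≤ 1 - σ := by linarith [hσ.2]
  have hu := (kinks_pos hσ (hγ.trans_le h))
  rw [upperKink_rpow hσ hγ, upperKink_rpow hσ (hγ.trans_le h)]
  exact mul_le_mul_of_nonneg_left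
    (Real.rpow_le_rpow (hu.1.trans hu.2).le (upperKink_anti hσ hγ h) hσ.1.le) hσ1

theorem criticalMarginal_le (hσ : σ ∈ Ioo (0 : ℝ) 1) {γ : ℝ} (hγ : 0 < γ) (q : ℝ) :
    criticalMarginal σ γ q ≤ γ := by
  unfold criticalMarginal
  split_ifs with h1 h2
  · exact hγ.le
  · exact (criticalMarginal_bounds hσ hγ (not_le.1 h1).le h2).2
  · exact le_rfl

/-- A higher parameter means a higher marginal cost at every quantity. -/
theorem criticalMarginal_mono_param (hσ : σ ∈ Ioo (0 : ℝ) 1) {γ γ' : ℝ} (hγ : 0 < γ)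
    (h : γ ≤ γ') (q : ℝ) : criticalMarginal σ γ q ≤ criticalMarginal σ γ' q := by
  have hγ' := hγ.trans_le h
  have hl := lowerKink_anti hσ hγ h
  have hu := upperKink_anti hσ hγ h
  by_cases h1 : q ≤ lowerKink σ γ
  · rw [criticalMarginal, if_pos h1]
    exact criticalMarginal_nonneg hσ hγ' q
  · by_cases h2 : q ≤ upperKink σ γ'
    · have hq : 0 < q := (kinks_pos hσ hγ).1.trans (not_le.1 h1)
      rw [criticalMarginal, criticalMarginal, if_neg h1, if_pos (h2.trans hu),
        if_neg (fun h3 => h1 (h3.trans hl)), if_pos h2]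
      have := div_le_div_of_nonneg_right (logCoeff_anti hσ hγ h) hq.le
      linarith
    · have : criticalMarginal σ γ' q = γ' := by
        rw [criticalMarginal, if_neg (fun h3 => h1 (h3.trans hl)), if_neg h2]
      rw [this]
      exact (criticalMarginal_le hσ hγ q).trans h

/-- The increments of the critical cost functions increase with the parameter. -/
theorem criticalCostFun_sub_le (hσ : σ ∈ Ioo (0 : ℝ) 1) {γ γ' x y : ℝ} (hγ : 0 < γ)
    (h : γ ≤ γ') (hx : 0 ≤ x) (hxy : x ≤ y) :
    criticalCostFun σ γ y - criticalCostFun σ γ x ≤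
      criticalCostFun σ γ' y - criticalCostFun σ γ' x := by
  have hγ' := hγ.trans_le h
  have hd : ∀ q ∈ interior (Ici (0 : ℝ)),
      HasDerivAt (fun q => criticalCostFun σ γ' q - criticalCostFun σ γ q)
        (criticalMarginal σ γ' q - criticalMarginal σ γ q) q := by
    intro q hq
    rw [interior_Ici] at hq
    exact (hasDerivAt_criticalCostFun hσ hγ' hq).sub (hasDerivAt_criticalCostFun hσ hγ hq)
  have hmono := monotoneOn_of_deriv_nonneg (convex_Ici (0 : ℝ))
    ((isCostFunction_critical hσ hγ').continuousOn.sub (isCostFunction_critical hσ hγ).continuousOn)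
    (fun q hq => (hd q hq).differentiableAt.differentiableWithinAt)
    (fun q hq => (hd q hq).deriv ▸ sub_nonneg.2 (criticalMarginal_mono_param hσ hγ h q))
    (mem_Ici.2 hx) (mem_Ici.2 (hx.trans hxy)) hxy
  simp only [Pi.sub_apply] at hmono
  linarith

theorem criticalCostFun_mono_param (hσ : σ ∈ Ioo (0 : ℝ) 1) {γ γ' q : ℝ} (hγ : 0 < γ)
    (h : γ ≤ γ') (hq : 0 ≤ q) : criticalCostFun σ γ q ≤ criticalCostFun σ γ' q := by
  have h1 := criticalCostFun_sub_le hσ hγ h le_rfl hq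
  rwa [(isCostFunction_critical hσ hγ).zero, (isCostFunction_critical hσ (hγ.trans_le h)).zero,
    sub_zero, sub_zero] at h1

theorem criticalCostFun_lipschitz (hσ : σ ∈ Ioo (0 : ℝ) 1) {γ x y : ℝ} (hγ : 0 < γ)
    (hx : 0 ≤ x) (hxy : x ≤ y) :
    criticalCostFun σ γ y - criticalCostFun σ γ x ≤ γ * (y - x) := by
  have hd : ∀ q ∈ interior (Ici (0 : ℝ)), HasDerivAt (fun q => γ * q - criticalCostFun σ γ q)
      (γ - criticalMarginal σ γ q) q := by
    intro q hq
    rw [interior_Ici] at hq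
    have h := ((hasDerivAt_id q).const_mul γ).sub (hasDerivAt_criticalCostFun hσ hγ hq)
    rwa [mul_one] at h
  have hmono := monotoneOn_of_deriv_nonneg (convex_Ici (0 : ℝ))
    ((by fun_prop : ContinuousOn (fun q => γ * q) (Ici 0)).sub
      (isCostFunction_critical hσ hγ).continuousOn)
    (fun q hq => (hd q hq).differentiableAt.differentiableWithinAt)
    (fun q hq => (hd q hq).deriv ▸ sub_nonneg.2 (criticalMarginal_le hσ hγ q))
    (mem_Ici.2 hx) (mem_Ici.2 (hx.trans hxy)) hxy
  simp only [Pi.sub_apply] at hmono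
  linarith

theorem criticalCostFun_of_mem (hσ : σ ∈ Ioo (0 : ℝ) 1) {γ q : ℝ} (hγ : 0 < γ)
    (h1 : lowerKink σ γ ≤ q) (h2 : q ≤ upperKink σ γ) :
    criticalCostFun σ γ q = middleCost σ γ q := by
  rcases h1.eq_or_lt with rfl | h
  · simp [criticalCostFun, middleCost, (kinks_pos hσ hγ).1.ne']
  · rw [criticalCostFun, if_neg (not_le.2 h), if_pos h2]

theorem criticalCostFun_of_le (hσ : σ ∈ Ioo (0 : ℝ) 1) {γ q : ℝ} (hγ : 0 < γ)
    (h : upperKink σ γ ≤ q) : criticalCostFun σ γ q =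
      criticalCostFun σ γ (upperKink σ γ) + γ * (q - upperKink σ γ) := by
  have hk := (kinks_pos hσ hγ).2
  rw [criticalCostFun_of_mem hσ hγ hk.le le_rfl]
  rcases h.eq_or_lt with rfl | h
  · rw [criticalCostFun_of_mem hσ hγ hk.le le_rfl]; simp
  · rw [criticalCostFun, if_neg (not_le.2 (hk.trans h)), if_neg (not_le.2 h)]

theorem grossUtility_lowerKink (hσ : σ ∈ Ioo (0 : ℝ) 1) {γ : ℝ} (hγ : 0 < γ) :
    grossUtility σ (lowerKink σ γ) = logCoeff σ γ / σ := by
  rw [grossUtility, lowerKink_rpow hσ hγ]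

theorem grossUtility_upperKink (hσ : σ ∈ Ioo (0 : ℝ) 1) {γ : ℝ} (hγ : 0 < γ) :
    grossUtility σ (upperKink σ γ) = logCoeff σ γ / ((1 - σ) * σ) := by
  have hσ0 := hσ.1.ne'
  have hσ1 : 1 - σ ≠ 0 := by linarith [hσ.2]
  rw [grossUtility, upperKink_rpow hσ hγ]
  field_simp

theorem mul_upperKink (hσ : σ ∈ Ioo (0 : ℝ) 1) {γ : ℝ} (hγ : 0 < γ) :
    γ * upperKink σ γ = logCoeff σ γ * σ / (1 - σ) := by
  have hσ0 := hσ.1.ne'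
  have hσ1 : 1 - σ ≠ 0 := by linarith [hσ.2]
  have hk := kinks_pos hσ hγ
  have hu := hk.1.trans hk.2
  have h1 : upperKink σ γ ^ σ = γ / σ * upperKink σ γ := by
    rw [← upperKink_rpow_sub_one hσ hγ, ← Real.rpow_add_one hu.ne', sub_add_cancel]
  rw [upperKink_rpow hσ hγ, h1]
  field_simp

theorem log_upperKink_div (hσ : σ ∈ Ioo (0 : ℝ) 1) {γ : ℝ} (hγ : 0 < γ) :
    Real.log (upperKink σ γ / lowerKink σ γ) = -Real.log (1 - σ) / σ := by
  have hσ1 : 0 < 1 - σ := by linarith [hσ.2]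
  have hk := kinks_pos hσ hγ
  have hu := hk.1.trans hk.2
  have h : lowerKink σ γ = (1 - σ) ^ (1 / σ) * upperKink σ γ := rfl
  rw [Real.log_div hu.ne' hk.1.ne', h,
    Real.log_mul (Real.rpow_pos_of_pos hσ1 _).ne' hu.ne', Real.log_rpow hσ1]
  ring

theorem criticalCostFun_upperKink (hσ : σ ∈ Ioo (0 : ℝ) 1) {γ : ℝ} (hγ : 0 < γ) :
    criticalCostFun σ γ (upperKink σ γ) =
      logCoeff σ γ * (1 / (1 - σ) + Real.log (1 - σ) / σ) := by
  have hσ0 := hσ.1.ne'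
  have hσ1 : 1 - σ ≠ 0 := by linarith [hσ.2]
  rw [criticalCostFun_of_mem hσ hγ (kinks_pos hσ hγ).2.le le_rfl, middleCost,
    grossUtility_upperKink hσ hγ, grossUtility_lowerKink hσ hγ, log_upperKink_div hσ hγ]
  field_simp
  ring

theorem indirectUtility_eq_logCoeff (hσ : σ ∈ Ioo (0 : ℝ) 1) {γ p : ℝ} (hγ : 0 < γ)
    (hp : 0 < p) : indirectUtility σ (γ * p) =
      logCoeff σ γ * (p ^ (-(σ / (1 - σ))) * σ ^ (-(σ / (1 - σ))) / σ) := by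
  have hσ0 := hσ.1
  have h : (0 : ℝ) < σ ^ (σ / (1 - σ)) := Real.rpow_pos_of_pos hσ0 _
  rw [indirectUtility, logCoeff, Real.mul_rpow hγ.le hp.le, Real.div_rpow hσ0.le hγ.le,
    Real.rpow_neg hγ.le, Real.rpow_neg hσ0.le]
  field_simp

theorem socialSurplus_criticalCost (hσ : σ ∈ Ioo (0 : ℝ) 1) (γ : Ioi (0 : ℝ)) :
    socialSurplus (criticalCost hσ γ) = logCoeff σ γ / (σ * saddleValue σ) := by
  have hσ0 := hσ.1
  have hσ1 : 0 < 1 - σ := by linarith [hσ.2]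
  have hγ : 0 < (γ : ℝ) := γ.2
  have hk := kinks_pos hσ hγ
  set C := criticalCostFun σ γ (upperKink σ γ) with hC
  have hline : ∀ q : ℝ, 0 ≤ q → C - γ * upperKink σ γ + γ * q ≤ (criticalCost hσ γ).1 q := by
    intro q hq
    change _ ≤ criticalCostFun σ γ q
    rcases le_total q (upperKink σ γ) with h | h
    · linarith [criticalCostFun_lipschitz hσ hγ hq h]
    · linarith [criticalCostFun_of_le hσ hγ h]
  have hq : upperKink σ γ ≤ (γ : ℝ) ^ (-(1 / (1 - σ))) := by
    rw [upperKink, Real.div_rpow hσ0.le hγ.le, Real.rpow_neg hγ.le, div_eq_mul_inv]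
    exact mul_le_of_le_one_left (by positivity)
      (Real.rpow_le_one hσ0.le hσ.2.le (by positivity))
  rw [socialSurplus_eq_of_line hσ (criticalCost hσ γ) hγ hline]
  · have h := indirectUtility_eq_logCoeff hσ hγ one_pos
    rw [mul_one, Real.one_rpow, one_mul] at h
    rw [h, hC, criticalCostFun_upperKink hσ hγ, mul_upperKink hσ hγ, saddleValue, neg_div]
    have hden := (saddleValue_denom_pos hσ).2
    rw [neg_div] at hden
    generalize σ ^ (-(σ / (1 - σ))) = s at *
    field_simp
    ring
  · change criticalCostFun σ γ _ = _
    linarith [criticalCostFun_of_le hσ hγ hq]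

/-! ### The seller's behaviour along the critical family -/

/-- The seller's profit from the mechanism `t` at the critical cost function. -/
noncomputable def criticalProfit (hσ : σ ∈ Ioo (0 : ℝ) 1) (t : Mechanism σ) (γ : Ioi (0 : ℝ)) :
    ℝ :=
  t.1 (supply (criticalCost hσ γ) t) - criticalCostFun σ γ (supply (criticalCost hσ γ) t)

theorem criticalProfit_nonneg (hσ : σ ∈ Ioo (0 : ℝ) 1) (t : Mechanism σ) (γ : Ioi (0 : ℝ)) :
    0 ≤ criticalProfit hσ t γ :=
  profit_nonneg (criticalCost hσ γ) t

/-- Revealed preference: a seller with parameter `γ` can imitate one with parameter `γ'`. -/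
theorem criticalProfit_add_le (hσ : σ ∈ Ioo (0 : ℝ) 1) (t : Mechanism σ) (γ γ' : Ioi (0 : ℝ)) :
    criticalProfit hσ t γ' + (criticalCostFun σ γ' (supply (criticalCost hσ γ') t) -
      criticalCostFun σ γ (supply (criticalCost hσ γ') t)) ≤ criticalProfit hσ t γ := by
  have h := supply_optimal (criticalCost hσ γ) t (supply_nonneg (criticalCost hσ γ') t)
  simp only [criticalProfit, criticalCost] at h ⊢
  linarith

theorem antitone_criticalProfit (hσ : σ ∈ Ioo (0 : ℝ) 1) (t : Mechanism σ) :
    Antitone (criticalProfit hσ t) := by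
  intro γ γ' h
  have h1 := criticalProfit_add_le hσ t γ γ'
  have h2 := criticalCostFun_mono_param hσ γ.2 h (supply_nonneg (criticalCost hσ γ') t)
  linarith

theorem antitone_supply_criticalCost (hσ : σ ∈ Ioo (0 : ℝ) 1) (t : Mechanism σ) :
    Antitone fun γ => supply (criticalCost hσ γ) t := by
  intro γ γ' h
  by_contra! hlt
  have h0 := supply_nonneg (criticalCost hσ γ) t
  have h1 := lt_of_lt_supply (criticalCost hσ γ') t h0 hlt
  have h2 := supply_optimal (criticalCost hσ γ) t (supply_nonneg (criticalCost hσ γ') t)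
  have h3 := criticalCostFun_sub_le hσ γ.2 h h0 hlt.le
  simp only [criticalCost] at h1 h2 h3
  linarith

theorem buyerSurplus_criticalCost (hσ : σ ∈ Ioo (0 : ℝ) 1) (t : Mechanism σ) (γ : Ioi (0 : ℝ)) :
    buyerSurplus (criticalCost hσ γ) t = grossUtility σ (supply (criticalCost hσ γ) t) -
      criticalCostFun σ γ (supply (criticalCost hσ γ) t) - criticalProfit hσ t γ := by
  simp only [buyerSurplus, criticalProfit]
  ring

theorem measurable_logCoeff : Measurable fun γ : Ioi (0 : ℝ) => logCoeff σ γ := by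
  unfold logCoeff
  fun_prop

theorem measurable_criticalCostFun {g : Ioi (0 : ℝ) → ℝ} (hg : Measurable g) :
    Measurable fun γ : Ioi (0 : ℝ) => criticalCostFun σ γ (g γ) := by
  have hκ := measurable_logCoeff (σ := σ)
  have hl : Measurable fun γ : Ioi (0 : ℝ) => lowerKink σ γ := by unfold lowerKink; fun_prop
  have hu : Measurable fun γ : Ioi (0 : ℝ) => upperKink σ γ := by unfold upperKink; fun_prop
  have hm : ∀ {f : Ioi (0 : ℝ) → ℝ}, Measurable f →
      Measurable fun γ : Ioi (0 : ℝ) => middleCost σ γ (f γ) := by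
    intro f hf
    unfold middleCost grossUtility
    exact (((hf.pow_const σ).div_const σ).sub ((hl.pow_const σ).div_const σ)).sub
      (hκ.mul (hf.div hl).log)
  unfold criticalCostFun
  refine Measurable.ite (measurableSet_le hg hl) measurable_const ?_
  refine Measurable.ite (measurableSet_le hg hu) (hm hg) ?_
  exact (hm hu).add (measurable_subtype_coe.mul (hg.sub hu))

theorem measurable_buyerSurplus_criticalCost (hσ : σ ∈ Ioo (0 : ℝ) 1) (t : Mechanism σ) :
    Measurable fun γ => buyerSurplus (criticalCost hσ γ) t := by
  have hq := (antitone_supply_criticalCost hσ t).measurable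
  simp only [buyerSurplus_criticalCost]
  refine Measurable.sub (Measurable.sub ?_ (measurable_criticalCostFun hq))
    (antitone_criticalProfit hσ t).measurable
  unfold grossUtility
  exact (hq.pow_const σ).div_const σ

theorem measurable_socialSurplus_criticalCost (hσ : σ ∈ Ioo (0 : ℝ) 1) :
    Measurable fun γ => socialSurplus (criticalCost hσ γ) := by
  simp only [socialSurplus_criticalCost]
  exact measurable_logCoeff.div_const _

theorem measurable_criticalCost (hσ : σ ∈ Ioo (0 : ℝ) 1) : Measurable (criticalCost hσ) :=
  measurable_to_costFunction (measurable_socialSurplus_criticalCost hσ)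
    (measurable_buyerSurplus_criticalCost hσ)

/-! ### The virtual surplus -/

theorem logCoeff_div (hσ : σ ∈ Ioo (0 : ℝ) 1) {γ k : ℝ} (hγ : 0 < γ) (hk : 0 < k) :
    logCoeff σ (γ / k) = k ^ (σ / (1 - σ)) * logCoeff σ γ := by
  have hσ0 := hσ.1
  rw [logCoeff, logCoeff, div_div_eq_mul_div, mul_comm σ k, mul_div_assoc,
    Real.mul_rpow hk.le (by positivity)]
  ring

theorem lowerKink_div (hσ : σ ∈ Ioo (0 : ℝ) 1) {γ k : ℝ} (hγ : 0 < γ) (hk : 0 < k) :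
    lowerKink σ (γ / k) = k ^ (1 / (1 - σ)) * lowerKink σ γ := by
  have hσ0 := hσ.1
  rw [lowerKink, lowerKink, div_div_eq_mul_div, mul_comm σ k, mul_div_assoc,
    Real.mul_rpow hk.le (by positivity)]
  ring

/-- The middle branch is nonnegative everywhere, with its minimum at the lower kink. -/
theorem middleCost_nonneg (hσ : σ ∈ Ioo (0 : ℝ) 1) {γ q : ℝ} (hγ : 0 < γ) (hq : 0 < q) :
    0 ≤ middleCost σ γ q := by
  have hσ0 := hσ.1
  have hl := (kinks_pos hσ hγ).1
  have hκ := logCoeff_pos hσ hγ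
  have h1 : q ^ σ = logCoeff σ γ * Real.exp (σ * Real.log (q / lowerKink σ γ)) := by
    rw [← lowerKink_rpow hσ hγ, mul_comm σ, ← Real.rpow_def_of_pos (by positivity),
      ← Real.mul_rpow hl.le (by positivity), mul_div_cancel₀ _ hl.ne']
  have h2 := Real.add_one_le_exp (σ * Real.log (q / lowerKink σ γ))
  rw [middleCost, grossUtility_lowerKink hσ hγ, grossUtility, h1]
  generalize Real.log (q / lowerKink σ γ) = l at *
  have h3 : logCoeff σ γ * Real.exp (σ * l) / σ - logCoeff σ γ / σ - logCoeff σ γ * l =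
      logCoeff σ γ / σ * (Real.exp (σ * l) - (σ * l + 1)) := by
    field_simp
    ring
  rw [h3]
  exact mul_nonneg (by positivity) (by linarith)

/-- Bound for the virtual surplus on the middle branch, in units of `logCoeff`. -/
noncomputable def middleBound (σ k E : ℝ) : ℝ :=
  (1 / σ + -Real.log (1 - σ) / σ) * ((E - k ^ (σ / (1 - σ))) / (E - 1)) +
    k ^ (σ / (1 - σ)) * (Real.log k / (1 - σ)) / (E - 1)

/-- The slope of the virtual cost beyond the upper kink, in units of `γ`. -/
noncomputable def virtualSlope (k E : ℝ) : ℝ := 1 + (1 - 1 / k) / (E - 1)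

/-- Bound for the virtual surplus at all quantities, in units of `logCoeff`: the bound on the middle
branch plus the maximal gain beyond the upper kink. -/
noncomputable def virtualBound (σ k E : ℝ) : ℝ :=
  middleBound σ k E +
    (virtualSlope k E ^ (-(σ / (1 - σ))) * σ ^ (-(σ / (1 - σ))) / σ - 1 / ((1 - σ) * σ) +
      virtualSlope k E * (σ / (1 - σ)))

/-- The surplus net of production cost and of the discrete information rent. The parameter `E` is
the factor by which the distribution of `γ` is scaled when `γ` is divided by `k`. -/
noncomputable def virtualSurplus (σ k E γ q : ℝ) : ℝ :=
  grossUtility σ q - criticalCostFun σ γ q -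
    (criticalCostFun σ γ q - criticalCostFun σ (γ / k) q) / (E - 1)

theorem virtualSurplus_le_middle (hσ : σ ∈ Ioo (0 : ℝ) 1) {γ k E q : ℝ} (hγ : 0 < γ) (hk : 1 < k)
    (hE : 1 < E) (hkE : k ^ (σ / (1 - σ)) ≤ E) (h1 : lowerKink σ γ ≤ q)
    (h2 : q ≤ upperKink σ γ) :
    virtualSurplus σ k E γ q ≤ logCoeff σ γ * middleBound σ k E := by
  have hσ0 := hσ.1
  have hσ1 : 0 < 1 - σ := by linarith [hσ.2]
  have hk0 : 0 < k := by linarith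
  have hE1 : 0 < E - 1 := by linarith
  have hl := (kinks_pos hσ hγ).1
  have hq := hl.trans_le h1
  have hκ := logCoeff_pos hσ hγ
  have hγk : 0 < γ / k := by positivity
  have hc := criticalCostFun_of_mem hσ hγ h1 h2
  have hc' : criticalCostFun σ (γ / k) q ≤ middleCost σ (γ / k) q := by
    rcases le_total q (lowerKink σ (γ / k)) with h | h
    · rw [criticalCostFun, if_pos h]
      exact middleCost_nonneg hσ hγk hq
    · exact (criticalCostFun_of_mem hσ hγk h
        (h2.trans (upperKink_anti hσ hγk (div_le_self hγ.le hk.le)))).le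
  have hlog : Real.log (q / lowerKink σ (γ / k)) =
      Real.log (q / lowerKink σ γ) - Real.log k / (1 - σ) := by
    rw [lowerKink_div hσ hγ hk0, Real.log_div hq.ne' (by positivity),
      Real.log_mul (by positivity) hl.ne', Real.log_rpow hk0, Real.log_div hq.ne' hl.ne']
    ring
  have hL : Real.log (q / lowerKink σ γ) ≤ -Real.log (1 - σ) / σ := by
    rw [← log_upperKink_div hσ hγ]
    exact Real.log_le_log (by positivity) (div_le_div_of_nonneg_right h2 hl.le)
  rw [middleCost, grossUtility_lowerKink hσ hγk, logCoeff_div hσ hγ hk0, hlog] at hc'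
  rw [middleCost, grossUtility_lowerKink hσ hγ] at hc
  rw [virtualSurplus, middleBound]
  generalize Real.log (q / lowerKink σ γ) = L at *
  generalize -Real.log (1 - σ) / σ = L' at *
  generalize k ^ (σ / (1 - σ)) = A at *
  generalize Real.log k / (1 - σ) = l at *
  generalize logCoeff σ γ = κ at *
  have h3 := div_le_div_of_nonneg_right (sub_le_sub_left hc' (criticalCostFun σ γ q)) hE1.le
  have h4 : grossUtility σ q - criticalCostFun σ γ q -
      (criticalCostFun σ γ q - (grossUtility σ q - A * κ / σ - A * κ * (L - l))) / (E - 1) =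
      κ * ((1 / σ + L) * ((E - A) / (E - 1)) + A * l / (E - 1)) := by
    rw [hc]
    field_simp
    ring
  have h5 : 0 ≤ (E - A) / (E - 1) := div_nonneg (by linarith) hE1.le
  have h6 : κ * ((1 / σ + L) * ((E - A) / (E - 1)) + A * l / (E - 1)) ≤
      κ * ((1 / σ + L') * ((E - A) / (E - 1)) + A * l / (E - 1)) := by
    gcongr
  linarith

theorem virtualSurplus_le (hσ : σ ∈ Ioo (0 : ℝ) 1) {γ k E q : ℝ} (hγ : 0 < γ) (hk : 1 < k)
    (hE : 1 < E) (hkE : k ^ (σ / (1 - σ)) ≤ E) (hq : 0 ≤ q) :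
    virtualSurplus σ k E γ q ≤ logCoeff σ γ * virtualBound σ k E := by
  have hσ0 := hσ.1
  have hσ1 : 0 < 1 - σ := by linarith [hσ.2]
  have hk0 : 0 < k := by linarith
  have hE1 : 0 < E - 1 := by linarith
  obtain ⟨hl, hlu⟩ := kinks_pos hσ hγ
  have hγk : 0 < γ / k := by positivity
  have hle : γ / k ≤ γ := div_le_self hγ.le hk.le
  have hp : 0 < virtualSlope k E := by
    have : 1 / k < 1 := by rw [div_lt_one hk0]; exact hk
    have : 0 < (1 - 1 / k) / (E - 1) := div_pos (by linarith) hE1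
    unfold virtualSlope; linarith
  -- the maximal gain beyond the upper kink
  have hgain : ∀ x, 0 ≤ x → grossUtility σ x - grossUtility σ (upperKink σ γ) -
      γ * virtualSlope k E * (x - upperKink σ γ) ≤
      logCoeff σ γ * (virtualBound σ k E - middleBound σ k E) := by
    intro x hx
    have h1 := grossUtility_sub_le hσ (mul_pos hγ hp) hx
    rw [indirectUtility_eq_logCoeff hσ hγ hp] at h1
    have h2 := mul_upperKink hσ hγ
    have h3 := grossUtility_upperKink hσ hγ
    have h4 : γ * virtualSlope k E * upperKink σ γ =
      virtualSlope k E * (logCoeff σ γ * σ / (1 - σ)) := by rw [← h2]; ring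
    have h5 : logCoeff σ γ * (virtualBound σ k E - middleBound σ k E) = logCoeff σ γ *
        (virtualSlope k E ^ (-(σ / (1 - σ))) * σ ^ (-(σ / (1 - σ))) / σ) -
        logCoeff σ γ / ((1 - σ) * σ) + virtualSlope k E * (logCoeff σ γ * σ / (1 - σ)) := by
      rw [virtualBound]; ring
    rw [h5, h3, mul_sub, h4]
    linarith
  have hmid : logCoeff σ γ * middleBound σ k E ≤ logCoeff σ γ * virtualBound σ k E := by
    have h := hgain (upperKink σ γ) (hl.trans hlu).le
    simp only [sub_self, mul_zero] at h
    linarith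
  rcases le_total q (lowerKink σ γ) with h1 | h1
  · have h2 := virtualSurplus_le_middle hσ hγ hk hE hkE le_rfl hlu.le
    have h3 := lowerKink_anti hσ hγk hle
    rw [virtualSurplus] at h2 ⊢
    rw [criticalCostFun, criticalCostFun, if_pos le_rfl, if_pos h3] at h2
    rw [criticalCostFun, criticalCostFun, if_pos h1, if_pos (h1.trans h3)]
    linarith [grossUtility_mono hσ hq h1]
  · rcases le_total q (upperKink σ γ) with h2 | h2
    · exact (virtualSurplus_le_middle hσ hγ hk hE hkE h1 h2).trans hmid
    · have h3 := virtualSurplus_le_middle hσ hγ hk hE hkE hlu.le le_rfl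
      have h4 := hgain q hq
      have h5 := criticalCostFun_of_le hσ hγ h2
      have h6 := criticalCostFun_lipschitz hσ hγk (hl.trans hlu).le h2
      rw [virtualSurplus] at h3 ⊢
      have h7 : γ * virtualSlope k E * (q - upperKink σ γ) = γ * (q - upperKink σ γ) +
          (γ * (q - upperKink σ γ) - γ / k * (q - upperKink σ γ)) / (E - 1) := by
        rw [virtualSlope]; field_simp
      rw [h7] at h4
      have h8 := div_le_div_of_nonneg_right (a := criticalCostFun σ γ (upperKink σ γ) -
        criticalCostFun σ (γ / k) (upperKink σ γ) +
        (γ * (q - upperKink σ γ) - γ / k * (q - upperKink σ γ)))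
        (b := criticalCostFun σ γ q - criticalCostFun σ (γ / k) q) (by linarith) hE1.le
      rw [add_div] at h8
      linarith

/-- Division of the parameter by a constant. -/
noncomputable def shrink {k : ℝ} (hk : 1 < k) (γ : Ioi (0 : ℝ)) : Ioi (0 : ℝ) :=
  ⟨γ / k, div_pos γ.2 (zero_lt_one.trans hk)⟩

theorem measurable_shrink {k : ℝ} (hk : 1 < k) : Measurable (shrink hk) :=
  Measurable.subtype_mk (measurable_subtype_coe.div_const k)

/-- The main estimate against the critical family. If dividing the parameter by `k` inflates its
distribution `μ` at most by the factor `E`, then integrating the revealed preference inequality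
between `γ / k` and `γ` bounds the expected profit from below by the expected information rent, and
hence the buyer surplus by the virtual surplus. -/
theorem lintegral_gap_ge (hσ : σ ∈ Ioo (0 : ℝ) 1) {k E : ℝ} (hk : 1 < k) (hE : 1 < E)
    (hkE : k ^ (σ / (1 - σ)) ≤ E) {μ : Measure (Ioi (0 : ℝ))}
    (hμ : μ.map (shrink hk) ≤ ENNReal.ofReal E • μ) (t : Mechanism σ) :
    ∫⁻ γ, ENNReal.ofReal (socialSurplus (criticalCost hσ γ) - logCoeff σ γ * virtualBound σ k E) ∂μ
      ≤ ∫⁻ γ, ENNReal.ofReal (socialSurplus (criticalCost hσ γ) -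
          buyerSurplus (criticalCost hσ γ) t) ∂μ := by
  have hE1 : 0 < E - 1 := by linarith
  set q : Ioi (0 : ℝ) → ℝ := fun γ => supply (criticalCost hσ γ) t with hq
  have hqm : Measurable q := (antitone_supply_criticalCost hσ t).measurable
  have hπm : Measurable (criticalProfit hσ t) := (antitone_criticalProfit hσ t).measurable
  set Δ : Ioi (0 : ℝ) → ℝ := fun γ =>
    criticalCostFun σ γ (q γ) - criticalCostFun σ (shrink hk γ) (q γ) with hΔ
  have hΔ0 : ∀ γ, 0 ≤ Δ γ := fun γ => sub_nonneg.2 (criticalCostFun_mono_param hσ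
    (shrink hk γ).2 (div_le_self γ.2.le hk.le) (supply_nonneg _ _))
  set P := ∫⁻ γ, ENNReal.ofReal (criticalProfit hσ t γ) ∂μ with hP
  have hscale : P + ∫⁻ γ, ENNReal.ofReal (Δ γ) ∂μ ≤ ENNReal.ofReal E * P := by
    calc P + ∫⁻ γ, ENNReal.ofReal (Δ γ) ∂μ
        = ∫⁻ γ, ENNReal.ofReal (criticalProfit hσ t γ + Δ γ) ∂μ := by
          rw [hP, ← lintegral_add_left hπm.ennreal_ofReal]
          refine lintegral_congr fun γ => ?_
          rw [ENNReal.ofReal_add (criticalProfit_nonneg hσ t γ) (hΔ0 γ)]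
      _ ≤ ∫⁻ γ, ENNReal.ofReal (criticalProfit hσ t (shrink hk γ)) ∂μ :=
          lintegral_mono fun γ => ENNReal.ofReal_le_ofReal
            (criticalProfit_add_le hσ t (shrink hk γ) γ)
      _ = ∫⁻ γ, ENNReal.ofReal (criticalProfit hσ t γ) ∂(μ.map (shrink hk)) := by
          rw [lintegral_map hπm.ennreal_ofReal (measurable_shrink hk)]
      _ ≤ ∫⁻ γ, ENNReal.ofReal (criticalProfit hσ t γ) ∂(ENNReal.ofReal E • μ) :=
          lintegral_mono' hμ le_rfl
      _ = ENNReal.ofReal E * P := by rw [lintegral_smul_measure, smul_eq_mul]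
  have hrent : ∫⁻ γ, ENNReal.ofReal (Δ γ / (E - 1)) ∂μ ≤ P := by
    by_cases hPtop : P = ⊤
    · rw [hPtop]; exact le_top
    have h1 : ENNReal.ofReal E * P = P + ENNReal.ofReal (E - 1) * P := by
      conv_lhs => rw [show E = 1 + (E - 1) by ring]
      rw [ENNReal.ofReal_add zero_le_one hE1.le, ENNReal.ofReal_one, add_mul, one_mul]
    rw [h1] at hscale
    have h2 := ENNReal.le_of_add_le_add_left hPtop hscale
    calc ∫⁻ γ, ENNReal.ofReal (Δ γ / (E - 1)) ∂μ
        = ENNReal.ofReal (E - 1)⁻¹ * ∫⁻ γ, ENNReal.ofReal (Δ γ) ∂μ := by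
          rw [← lintegral_const_mul' _ _ ENNReal.ofReal_ne_top]
          refine lintegral_congr fun γ => ?_
          rw [← ENNReal.ofReal_mul (by positivity), div_eq_inv_mul]
      _ ≤ ENNReal.ofReal (E - 1)⁻¹ * (ENNReal.ofReal (E - 1) * P) := by gcongr
      _ = P := by
          rw [← mul_assoc, ← ENNReal.ofReal_mul (by positivity), inv_mul_cancel₀ hE1.ne',
            ENNReal.ofReal_one, one_mul]
  set S : Ioi (0 : ℝ) → ℝ := fun γ => socialSurplus (criticalCost hσ γ) -
    (buyerSurplus (criticalCost hσ γ) t + criticalProfit hσ t γ) with hS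
  have hSm : Measurable S := (measurable_socialSurplus_criticalCost hσ).sub
    ((measurable_buyerSurplus_criticalCost hσ t).add hπm)
  have hS0 : ∀ γ, 0 ≤ S γ := by
    intro γ
    have h := le_socialSurplus hσ (criticalCost hσ γ) (supply_nonneg (criticalCost hσ γ) t)
    simp only [hS, buyerSurplus_criticalCost]
    simp only [criticalCost] at h ⊢
    linarith
  calc _ ≤ ∫⁻ γ, (ENNReal.ofReal (S γ) + ENNReal.ofReal (Δ γ / (E - 1))) ∂μ := by
        refine lintegral_mono fun γ => ?_
        rw [← ENNReal.ofReal_add (hS0 γ) (div_nonneg (hΔ0 γ) hE1.le)]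
        refine ENNReal.ofReal_le_ofReal ?_
        have h := virtualSurplus_le hσ γ.2 hk hE hkE (supply_nonneg (criticalCost hσ γ) t)
        simp only [virtualSurplus] at h
        simp only [hS, hΔ, hq, shrink, buyerSurplus_criticalCost]
        linarith
    _ = ∫⁻ γ, ENNReal.ofReal (S γ) ∂μ + ∫⁻ γ, ENNReal.ofReal (Δ γ / (E - 1)) ∂μ :=
        lintegral_add_left hSm.ennreal_ofReal _
    _ ≤ ∫⁻ γ, ENNReal.ofReal (S γ) ∂μ + P := by gcongr
    _ = ∫⁻ γ, ENNReal.ofReal (socialSurplus (criticalCost hσ γ) -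
          buyerSurplus (criticalCost hσ γ) t) ∂μ := by
        rw [hP, ← lintegral_add_left hSm.ennreal_ofReal]
        refine lintegral_congr fun γ => ?_
        rw [← ENNReal.ofReal_add (hS0 γ) (criticalProfit_nonneg hσ t γ)]
        congr 1
        simp only [hS]
        ring

end CriticalFamily

/-! ### The power laws and their discrete analogues -/

section Laws

variable {σ : ℝ}

/-- The density of the power law, as a function on the whole line. -/
noncomputable def powerDensity (θ : ℝ) : ℝ → ENNReal :=
  (Ioc 0 1).indicator fun γ => ENNReal.ofReal (θ * γ ^ (θ - 1))

theorem measurable_powerDensity (θ : ℝ) : Measurable (powerDensity θ) :=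
  Measurable.indicator (by fun_prop) measurableSet_Ioc

theorem powerLaw_eq (θ : ℝ) :
    powerLaw θ = Measure.comap Subtype.val (volume.withDensity (powerDensity θ)) := by
  rw [powerLaw, powerDensity, withDensity_indicator measurableSet_Ioc]

theorem powerLaw_apply (θ : ℝ) {s : Set (Ioi (0 : ℝ))} (hs : MeasurableSet s) :
    powerLaw θ s = ∫⁻ x, (Subtype.val '' s).indicator (powerDensity θ) x := by
  have hs' := (MeasurableEmbedding.subtype_coe measurableSet_Ioi).measurableSet_image.2 hs
  rw [powerLaw_eq, (MeasurableEmbedding.subtype_coe measurableSet_Ioi).comap_apply,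
    withDensity_apply _ hs', lintegral_indicator hs']

theorem lintegral_powerLaw (θ : ℝ) (f : ℝ → ENNReal) :
    ∫⁻ γ, f γ ∂powerLaw θ = ∫⁻ x in Ioc 0 1, ENNReal.ofReal (θ * x ^ (θ - 1)) * f x := by
  have hsub : Ioi (0 : ℝ) ∩ Ioc 0 1 = Ioc 0 1 :=
    inter_eq_right.2 fun x hx => hx.1
  rw [powerLaw, lintegral_subtype_comap measurableSet_Ioi f, restrict_withDensity measurableSet_Ioi,
    Measure.restrict_restrict measurableSet_Ioi, hsub,
    lintegral_withDensity_eq_lintegral_mul_non_measurable₀]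
  · simp only [Pi.mul_apply]
  · exact Measurable.aemeasurable (by fun_prop)
  · exact ae_of_all _ fun x => ENNReal.ofReal_lt_top

theorem isProbabilityMeasure_powerLaw {θ : ℝ} (hθ : 0 < θ) :
    IsProbabilityMeasure (powerLaw θ) := by
  constructor
  rw [← lintegral_one, lintegral_powerLaw θ (fun _ => 1)]
  simp only [mul_one]
  have hint : IntegrableOn (fun x : ℝ => θ * x ^ (θ - 1)) (Ioc 0 1) :=
    (intervalIntegrable_iff_integrableOn_Ioc_of_le zero_le_one).1
      ((intervalIntegral.intervalIntegrable_rpow' (by linarith)).const_mul θ)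
  rw [← ofReal_integral_eq_lintegral_ofReal hint, ← intervalIntegral.integral_of_le zero_le_one,
    intervalIntegral.integral_const_mul, integral_rpow (Or.inl (by linarith))]
  · simp [Real.zero_rpow hθ.ne', hθ.ne']
  · filter_upwards [ae_restrict_mem measurableSet_Ioc] with x hx
    exact mul_nonneg hθ.le (Real.rpow_nonneg hx.1.le _)

/-- Dividing the parameter by `k` inflates the power law at most by the factor `k ^ θ`. -/
theorem map_shrink_powerLaw_le {θ k : ℝ} (hk : 1 < k) :
    (powerLaw θ).map (shrink hk) ≤ ENNReal.ofReal (k ^ θ) • powerLaw θ := by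
  have hk0 : 0 < k := by linarith
  refine Measure.le_iff.2 fun s hs => ?_
  have hs' := (MeasurableEmbedding.subtype_coe measurableSet_Ioi).measurableSet_image.2 hs
  rw [Measure.map_apply (measurable_shrink hk) hs, Measure.smul_apply, smul_eq_mul,
    powerLaw_apply θ (measurable_shrink hk hs), powerLaw_apply θ hs]
  have hm : Measurable ((Subtype.val '' (shrink hk ⁻¹' s)).indicator (powerDensity θ)) :=
    (measurable_powerDensity θ).indicator
      ((MeasurableEmbedding.subtype_coe measurableSet_Ioi).measurableSet_image.2
        (measurable_shrink hk hs))
  have hvol := Real.smul_map_volume_mul_left hk0.ne'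
  rw [abs_of_pos hk0] at hvol
  rw [← hvol, lintegral_smul_measure, lintegral_map hm (by fun_prop), hvol, smul_eq_mul]
  have hpt : ∀ x, (Subtype.val '' (shrink hk ⁻¹' s)).indicator (powerDensity θ) (k * x) ≤
      ENNReal.ofReal (k ^ (θ - 1)) * (Subtype.val '' s).indicator (powerDensity θ) x := by
    intro x
    by_cases hx : k * x ∈ Subtype.val '' (shrink hk ⁻¹' s)
    · obtain ⟨γ, hγ, hγx⟩ := id hx
      have hx0 : 0 < x := pos_of_mul_pos_right (hγx ▸ γ.2 : 0 < k * x) hk0.le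
      have hxs : x ∈ Subtype.val '' s :=
        ⟨shrink hk γ, hγ, by simp only [shrink, hγx]; field_simp⟩
      rw [indicator_of_mem hxs, indicator_of_mem hx, powerDensity]
      by_cases hx1 : k * x ∈ Ioc (0 : ℝ) 1
      · have hx2 : x ∈ Ioc (0 : ℝ) 1 := ⟨hx0, by nlinarith [hx1.2]⟩
        rw [indicator_of_mem hx1, indicator_of_mem hx2,
          ← ENNReal.ofReal_mul (by positivity), Real.mul_rpow hk0.le hx0.le]
        refine ENNReal.ofReal_le_ofReal (le_of_eq ?_)
        ring
      · rw [indicator_of_notMem hx1]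
        exact zero_le
    · rw [indicator_of_notMem hx]
      exact zero_le
  calc _ ≤ ENNReal.ofReal k * ∫⁻ x,
        ENNReal.ofReal (k ^ (θ - 1)) * (Subtype.val '' s).indicator (powerDensity θ) x := by
        gcongr with x
        exact hpt x
    _ = _ := by
        rw [lintegral_const_mul' _ _ ENNReal.ofReal_ne_top, ← mul_assoc,
          ← ENNReal.ofReal_mul hk0.le]
        congr 2
        rw [mul_comm, ← Real.rpow_add_one hk0.ne', sub_add_cancel]

theorem logCoeff_eq_mul_rpow (hσ : σ ∈ Ioo (0 : ℝ) 1) {γ : ℝ} (hγ : 0 < γ) :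
    logCoeff σ γ = (1 - σ) * σ ^ (σ / (1 - σ)) * γ ^ (-(σ / (1 - σ))) := by
  rw [logCoeff, Real.div_rpow hσ.1.le hγ.le, Real.rpow_neg hγ.le]
  ring

theorem integrable_socialSurplus_powerLaw (hσ : σ ∈ Ioo (0 : ℝ) 1) {θ : ℝ}
    (hθ : σ / (1 - σ) < θ) :
    Integrable (fun γ => socialSurplus (criticalCost hσ γ)) (powerLaw θ) := by
  have hσ0 := hσ.1
  have hσ1 : 0 < 1 - σ := by linarith [hσ.2]
  have hB := saddleValue_pos hσ
  have ha : 0 < σ / (1 - σ) := by positivity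
  refine ⟨(measurable_socialSurplus_criticalCost hσ).aestronglyMeasurable, ?_⟩
  rw [hasFiniteIntegral_iff_ofReal (ae_of_all _ fun γ => socialSurplus_nonneg hσ _)]
  set C := (1 - σ) * σ ^ (σ / (1 - σ)) / (σ * saddleValue σ) with hC
  have hC0 : 0 < C := by positivity
  have h1 : ∀ γ : Ioi (0 : ℝ), ENNReal.ofReal (socialSurplus (criticalCost hσ γ)) =
      ENNReal.ofReal (C * (γ : ℝ) ^ (-(σ / (1 - σ)))) := by
    intro γ
    rw [socialSurplus_criticalCost, logCoeff_eq_mul_rpow hσ γ.2, hC]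
    congr 1
    ring
  simp only [h1]
  rw [lintegral_powerLaw θ (fun x => ENNReal.ofReal (C * x ^ (-(σ / (1 - σ)))))]
  have hint : IntegrableOn (fun x : ℝ => θ * C * x ^ (θ - 1 - σ / (1 - σ))) (Ioc 0 1) :=
    (intervalIntegrable_iff_integrableOn_Ioc_of_le zero_le_one).1
      ((intervalIntegral.intervalIntegrable_rpow' (by linarith)).const_mul (θ * C))
  refine lt_of_eq_of_lt ?_ hint.lintegral_lt_top
  refine setLIntegral_congr_fun measurableSet_Ioc fun x hx => ?_
  have hx0 : 0 < x := hx.1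
  have hθ0 : 0 < θ := ha.trans hθ
  rw [← ENNReal.ofReal_mul (by positivity), sub_eq_add_neg _ (σ / (1 - σ)), Real.rpow_add hx0]
  congr 1
  ring

/-- The law of the critical cost function with a power-distributed parameter. -/
noncomputable def criticalDistribution (hσ : σ ∈ Ioo (0 : ℝ) 1) (θ : Ioi (σ / (1 - σ))) :
    CostDistribution σ where
  measure := (powerLaw θ).map (criticalCost hσ)
  prob := by
    have hσ1 : 0 < 1 - σ := by linarith [hσ.2]
    have := isProbabilityMeasure_powerLaw ((div_pos hσ.1 hσ1).trans θ.2)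
    exact Measure.isProbabilityMeasure_map (measurable_criticalCost hσ).aemeasurable
  finite_welfare := by
    rw [integrable_map_measure measurable_socialSurplus.aestronglyMeasurable
      (measurable_criticalCost hσ).aemeasurable]
    exact integrable_socialSurplus_powerLaw hσ θ.2

/-- The upper bound on the buyer's share of the surplus obtained from `lintegral_gap_ge` for the
exponent `θ`. The factor `k = exp (θ - σ / (1 - σ))` tends to one together with the limit in `θ`, so
that a single limit suffices. -/
noncomputable def criticalBound (σ θ : ℝ) : ℝ :=
  virtualBound σ (Real.exp (θ - σ / (1 - σ))) (Real.exp (θ - σ / (1 - σ)) ^ θ) *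
    (σ * saddleValue σ)

theorem tendsto_virtualBound (hσ : σ ∈ Ioo (0 : ℝ) 1) :
    Tendsto (fun θ => virtualBound σ (Real.exp (θ - σ / (1 - σ)))
      (Real.exp (θ - σ / (1 - σ)) ^ θ)) (𝓝[>] (σ / (1 - σ))) (𝓝 (1 / σ)) := by
  have hσ0 := hσ.1
  have hσ1 : 0 < 1 - σ := by linarith [hσ.2]
  set a := σ / (1 - σ) with ha
  have ha0 : 0 < a := by positivity
  have hsub : 𝓝[>] a ≤ 𝓝[≠] a :=
    nhdsWithin_mono a fun x (hx : x ∈ Ioi a) => (mem_Ioi.1 hx).ne'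
  have hid : HasDerivAt (fun θ : ℝ => θ - a) 1 a := (hasDerivAt_id a).sub_const a
  have hE : Tendsto (slope (fun θ => Real.exp ((θ - a) * θ)) a) (𝓝[>] a) (𝓝 a) := by
    have h := (hid.mul (hasDerivAt_id a)).exp
    simp only [Pi.mul_apply, id, sub_self, zero_mul, Real.exp_zero, one_mul, mul_one,
      add_zero] at h
    exact (hasDerivAt_iff_tendsto_slope.1 h).mono_left hsub
  have hA : Tendsto (slope (fun θ => Real.exp ((θ - a) * a)) a) (𝓝[>] a) (𝓝 a) := by
    have h := (hid.mul_const a).exp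
    simp only [sub_self, zero_mul, Real.exp_zero, one_mul] at h
    exact (hasDerivAt_iff_tendsto_slope.1 h).mono_left hsub
  have hK : Tendsto (slope (fun θ => -Real.exp (-(θ - a))) a) (𝓝[>] a) (𝓝 1) := by
    have h := hid.neg.exp.neg
    simp only [Pi.neg_apply, sub_self, neg_zero, Real.exp_zero, one_mul, neg_neg] at h
    exact (hasDerivAt_iff_tendsto_slope.1 h).mono_left hsub
  have hA1 : Tendsto (fun θ => Real.exp ((θ - a) * a)) (𝓝[>] a) (𝓝 1) := by
    have : Continuous fun θ => Real.exp ((θ - a) * a) := by fun_prop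
    simpa using (this.tendsto a).mono_left (nhdsWithin_le_nhds (s := Ioi a))
  have hmid : Tendsto (fun θ => (1 / σ + -Real.log (1 - σ) / σ) *
        (1 - slope (fun θ => Real.exp ((θ - a) * a)) a θ /
          slope (fun θ => Real.exp ((θ - a) * θ)) a θ) +
      Real.exp ((θ - a) * a) * (1 / (1 - σ)) / slope (fun θ => Real.exp ((θ - a) * θ)) a θ)
      (𝓝[>] a) (𝓝 ((1 / σ + -Real.log (1 - σ) / σ) * (1 - a / a) + 1 * (1 / (1 - σ)) / a)) :=
    ((tendsto_const_nhds.sub (hA.div hE ha0.ne')).const_mul _).add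
      ((hA1.mul_const _).div hE ha0.ne')
  have hp : Tendsto (fun θ => 1 + slope (fun θ => -Real.exp (-(θ - a))) a θ /
      slope (fun θ => Real.exp ((θ - a) * θ)) a θ) (𝓝[>] a) (𝓝 (1 + 1 / a)) :=
    (hK.div hE ha0.ne').const_add 1
  have hlim := hmid.add (((((hp.rpow_const (p := -a) (Or.inl (by positivity))).mul_const
    (σ ^ (-a))).div_const σ).sub_const (1 / ((1 - σ) * σ))).add (hp.mul_const a))
  have hval : (1 / σ + -Real.log (1 - σ) / σ) * (1 - a / a) + 1 * (1 / (1 - σ)) / a +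
      ((1 + 1 / a) ^ (-a) * σ ^ (-a) / σ - 1 / ((1 - σ) * σ) + (1 + 1 / a) * a) = 1 / σ := by
    have h1 : 1 + 1 / a = 1 / σ := by rw [ha]; field_simp; ring
    rw [h1, ← Real.mul_rpow (by positivity) hσ0.le, one_div_mul_cancel hσ0.ne', Real.one_rpow,
      div_self ha0.ne', sub_self, mul_zero, ha]
    field_simp
    ring
  rw [hval] at hlim
  refine hlim.congr' ?_
  filter_upwards [self_mem_nhdsWithin] with θ hθ
  have hδ : θ - a ≠ 0 := (sub_pos.2 (mem_Ioi.1 hθ)).ne'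
  have hθ0 : 0 < θ := ha0.trans (mem_Ioi.1 hθ)
  have hE1 : Real.exp ((θ - a) * θ) - 1 ≠ 0 := by
    have : 0 < (θ - a) * θ := mul_pos (sub_pos.2 (mem_Ioi.1 hθ)) hθ0
    exact (sub_pos.2 (Real.one_lt_exp_iff.2 this)).ne'
  have hm : slope (fun θ => -Real.exp (-(θ - a))) a θ /
      slope (fun θ => Real.exp ((θ - a) * θ)) a θ =
      (1 - 1 / Real.exp (θ - a)) / (Real.exp ((θ - a) * θ) - 1) := by
    simp only [slope_def_field, sub_self, zero_mul, neg_zero, Real.exp_zero]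
    rw [div_div_div_cancel_right₀ hδ, Real.exp_neg]
    congr 1
    ring
  have hA' : 1 - slope (fun θ => Real.exp ((θ - a) * a)) a θ /
      slope (fun θ => Real.exp ((θ - a) * θ)) a θ =
      (Real.exp ((θ - a) * θ) - Real.exp ((θ - a) * a)) / (Real.exp ((θ - a) * θ) - 1) := by
    simp only [slope_def_field, sub_self, zero_mul, Real.exp_zero]
    rw [div_div_div_cancel_right₀ hδ, eq_div_iff hE1, sub_mul, one_mul, div_mul_cancel₀ _ hE1]
    ring
  have hL : Real.exp ((θ - a) * a) * (1 / (1 - σ)) / slope (fun θ => Real.exp ((θ - a) * θ)) a θ =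
      Real.exp ((θ - a) * a) * ((θ - a) / (1 - σ)) / (Real.exp ((θ - a) * θ) - 1) := by
    simp only [slope_def_field, sub_self, zero_mul, Real.exp_zero]
    field_simp
  rw [hm, hA', hL, virtualBound, middleBound, virtualSlope, Real.log_exp, ← ha,
    ← Real.exp_mul, ← Real.exp_mul]

theorem tendsto_criticalBound (hσ : σ ∈ Ioo (0 : ℝ) 1) :
    Tendsto (criticalBound σ) (𝓝[>] (σ / (1 - σ))) (𝓝 (saddleValue σ)) := by
  have h := (tendsto_virtualBound hσ).mul_const (σ * saddleValue σ)
  rwa [← mul_assoc, one_div_mul_cancel hσ.1.ne', one_mul] at h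

/-- The estimate `lintegral_gap_ge` for measures scaling like the power law with exponent `θ`. -/
theorem lintegral_gap_ge_criticalBound (hσ : σ ∈ Ioo (0 : ℝ) 1) {θ : ℝ} (hθ : σ / (1 - σ) < θ)
    (hk : 1 < Real.exp (θ - σ / (1 - σ))) {μ : Measure (Ioi (0 : ℝ))}
    (hμ : μ.map (shrink hk) ≤ ENNReal.ofReal (Real.exp (θ - σ / (1 - σ)) ^ θ) • μ)
    (t : Mechanism σ) :
    ENNReal.ofReal (1 - criticalBound σ θ) *
        ∫⁻ γ, ENNReal.ofReal (socialSurplus (criticalCost hσ γ)) ∂μ ≤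
      ∫⁻ γ, ENNReal.ofReal (socialSurplus (criticalCost hσ γ) -
        buyerSurplus (criticalCost hσ γ) t) ∂μ := by
  have hσ0 := hσ.1
  have hσ1 : 0 < 1 - σ := by linarith [hσ.2]
  have hB := saddleValue_pos hσ
  have ha : 0 < σ / (1 - σ) := by positivity
  refine le_trans (le_of_eq ?_) (lintegral_gap_ge hσ hk
    (Real.one_lt_rpow hk (ha.trans hθ)) (Real.rpow_le_rpow_of_exponent_le hk.le hθ.le) hμ t)
  rw [← lintegral_const_mul' _ _ ENNReal.ofReal_ne_top]
  refine lintegral_congr fun γ => ?_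
  rw [← ENNReal.ofReal_mul' (socialSurplus_nonneg hσ _), socialSurplus_criticalCost, criticalBound]
  congr 1
  field_simp

theorem ratioAtMechanism_le_criticalBound (hσ : σ ∈ Ioo (0 : ℝ) 1) (θ : Ioi (σ / (1 - σ)))
    (t : Mechanism σ) :
    ratioAtMechanism (criticalDistribution hσ θ) t ≤ ((criticalBound σ θ : ℝ) : EReal) := by
  set G := criticalDistribution hσ θ with hG
  have hk : 1 < Real.exp ((θ : ℝ) - σ / (1 - σ)) :=
    Real.one_lt_exp_iff.2 (sub_pos.2 θ.2)
  have hm := measurable_criticalCost hσ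
  have hW := measurable_socialSurplus (σ := σ)
  have hU := measurable_buyerSurplus t
  have hWU : Measurable fun c : CostFunction σ => socialSurplus c - buyerSurplus c t := hW.sub hU
  have hμ : G.measure = (powerLaw θ).map (criticalCost hσ) := rfl
  rw [ratioAtMechanism, EReal.div_le_iff_le_mul (by exact_mod_cast G.welfare_pos hσ)
    (EReal.coe_ne_top _), ← EReal.coe_mul, CostDistribution.surplus]
  refine extIntegral_le_of_le_gap hU (socialSurplus_nonneg hσ)
    (fun c => buyerSurplus_le_socialSurplus hσ c t) G.finite_welfare ?_
  have h := lintegral_gap_ge_criticalBound hσ θ.2 hk (map_shrink_powerLaw_le hk) t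
  rw [hμ, lintegral_map hWU.ennreal_ofReal hm]
  refine le_trans (le_of_eq ?_) h
  rw [← lintegral_map hW.ennreal_ofReal hm, ← hμ,
    ← ofReal_integral_eq_lintegral_ofReal G.finite_welfare
      (ae_of_all _ (socialSurplus_nonneg hσ)),
    ← ENNReal.ofReal_mul' (integral_nonneg (socialSurplus_nonneg hσ)), CostDistribution.welfare]
  congr 1
  ring

/-- The discrete analogue of the power law: the parameter `k ^ (-i)` has the weight `E ^ (-i)`. Its
countable support makes the exchange of integrals with an arbitrary law of mechanisms
unproblematic. -/
noncomputable def geometricLaw {k : ℝ} (hk : 1 < k) (E : ℝ) : Measure (Ioi (0 : ℝ)) :=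
  Measure.sum fun i : ℕ =>
    ENNReal.ofReal (E⁻¹ ^ i) • Measure.dirac ((shrink hk)^[i] ⟨1, mem_Ioi.2 one_pos⟩)

theorem lintegral_geometricLaw {k : ℝ} (hk : 1 < k) (E : ℝ) (f : Ioi (0 : ℝ) → ENNReal) :
    ∫⁻ γ, f γ ∂geometricLaw hk E =
      ∑' i : ℕ, ENNReal.ofReal (E⁻¹ ^ i) * f ((shrink hk)^[i] ⟨1, mem_Ioi.2 one_pos⟩) := by
  simp only [geometricLaw, lintegral_sum_measure, lintegral_smul_measure, lintegral_dirac,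
    smul_eq_mul]

theorem map_shrink_geometricLaw_le {k E : ℝ} (hk : 1 < k) (hE : 0 < E) :
    (geometricLaw hk E).map (shrink hk) ≤ ENNReal.ofReal E • geometricLaw hk E := by
  refine Measure.le_iff.2 fun s hs => ?_
  have hind : Measurable (s.indicator (1 : Ioi (0 : ℝ) → ENNReal)) :=
    measurable_one.indicator hs
  rw [← lintegral_indicator_one hs, lintegral_map hind (measurable_shrink hk),
    lintegral_geometricLaw, Measure.smul_apply, ← lintegral_indicator_one hs,
    lintegral_geometricLaw, smul_eq_mul, ← ENNReal.tsum_mul_left]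
  refine le_trans (le_of_eq ?_) (ENNReal.tsum_comp_le_tsum_of_injective
    (add_left_injective (1 : ℕ)) _)
  refine tsum_congr fun i => ?_
  rw [Function.iterate_succ_apply', ← mul_assoc, ← ENNReal.ofReal_mul hE.le, pow_succ']
  congr 2
  field_simp

theorem lintegral_socialSurplus_geometricLaw (hσ : σ ∈ Ioo (0 : ℝ) 1) {k E : ℝ} (hk : 1 < k)
    (hkE : k ^ (σ / (1 - σ)) < E) :
    ∫⁻ γ, ENNReal.ofReal (socialSurplus (criticalCost hσ γ)) ∂geometricLaw hk E ≠ 0 ∧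
      ∫⁻ γ, ENNReal.ofReal (socialSurplus (criticalCost hσ γ)) ∂geometricLaw hk E ≠ ⊤ := by
  have hk0 : 0 < k := by linarith
  have hA : 0 < k ^ (σ / (1 - σ)) := Real.rpow_pos_of_pos hk0 _
  have hE : 0 < E := hA.trans hkE
  rw [lintegral_geometricLaw]
  have hκ : ∀ i : ℕ, logCoeff σ ((shrink hk)^[i] ⟨1, mem_Ioi.2 one_pos⟩ : Ioi (0 : ℝ)) =
      (k ^ (σ / (1 - σ))) ^ i * logCoeff σ 1 := by
    intro i
    induction i with
    | zero => simp
    | succ i ih =>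
      rw [Function.iterate_succ_apply']
      refine (logCoeff_div hσ (Subtype.prop _) hk0).trans ?_
      rw [ih]
      ring
  constructor
  · refine (lt_of_lt_of_le ?_ (ENNReal.le_tsum 0)).ne'
    simpa using socialSurplus_pos hσ _
  · have hterm : ∀ i : ℕ, ENNReal.ofReal (E⁻¹ ^ i) * ENNReal.ofReal
        (socialSurplus (criticalCost hσ ((shrink hk)^[i] ⟨1, mem_Ioi.2 one_pos⟩))) =
        ENNReal.ofReal ((k ^ (σ / (1 - σ)) / E) ^ i *
          (logCoeff σ 1 / (σ * saddleValue σ))) := by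
      intro i
      rw [← ENNReal.ofReal_mul (by positivity), socialSurplus_criticalCost, hκ i, div_pow, inv_pow]
      congr 1
      ring
    simp only [hterm]
    exact ((summable_geometric_of_lt_one (by positivity)
      ((div_lt_one hE).2 hkE)).mul_right _).tsum_ofReal_ne_top

theorem saddleValue_lt_one (hσ : σ ∈ Ioo (0 : ℝ) 1) : saddleValue σ < 1 := by
  have hσ0 := hσ.1
  have hσ1 : 0 < 1 - σ := by linarith [hσ.2]
  have h1 : 1 < σ ^ (-σ / (1 - σ)) := by
    refine Real.one_lt_rpow_of_pos_of_lt_one_of_neg hσ0 hσ.2 ?_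
    rw [neg_div, neg_lt_zero]
    positivity
  have h2 := Real.log_le_sub_one_of_pos hσ1
  rw [saddleValue, div_lt_one (saddleValue_denom_pos hσ).2]
  linarith

/-- No distribution over mechanisms guarantees more than `saddleValue σ`. -/
theorem iInf_ratioAtCost_le (hσ : σ ∈ Ioo (0 : ℝ) 1) (F : ProbabilityMeasure (Mechanism σ)) :
    ⨅ c : CostFunction σ, ratioAtCost F c ≤ ((saddleValue σ : ℝ) : EReal) := by
  by_contra! hlt
  obtain ⟨b, hb1, hb2⟩ := EReal.lt_iff_exists_real_btwn.1 hlt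
  have hb1' : saddleValue σ < b := by exact_mod_cast hb1
  have hgap : ∀ c : CostFunction σ,
      ∫⁻ t, ENNReal.ofReal (socialSurplus c - buyerSurplus c t) ∂(F : Measure (Mechanism σ)) ≤
        ENNReal.ofReal (1 - b) * ENNReal.ofReal (socialSurplus c) := by
    intro c
    have h1 : (b : EReal) ≤ ratioAtCost F c := hb2.le.trans (iInf_le _ c)
    rw [ratioAtCost, EReal.le_div_iff_mul_le (by exact_mod_cast socialSurplus_pos hσ c)
      (EReal.coe_ne_top _), ← EReal.coe_mul] at h1
    have h2 := gap_le_of_le_extIntegral (g := fun _ => socialSurplus c)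
      (measurable_buyerSurplus_right c) (fun _ => socialSurplus_nonneg hσ c)
      (fun t => buyerSurplus_le_socialSurplus hσ c t) (integrable_const _) h1
    refine h2.trans (le_of_eq ?_)
    rw [← ENNReal.ofReal_mul' (socialSurplus_nonneg hσ c), integral_const, probReal_univ, one_smul]
    congr 1
    ring
  have hev := (tendsto_criticalBound hσ).eventually
    (gt_mem_nhds (lt_min hb1' (saddleValue_lt_one hσ)))
  obtain ⟨θ, hθlt, hθ⟩ := (hev.and self_mem_nhdsWithin).exists
  replace hθ : σ / (1 - σ) < θ := hθ
  have hσ1 : 0 < 1 - σ := by linarith [hσ.2]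
  have hk : 1 < Real.exp (θ - σ / (1 - σ)) := Real.one_lt_exp_iff.2 (sub_pos.2 hθ)
  set E := Real.exp (θ - σ / (1 - σ)) ^ θ with hE
  have hE0 : 0 < E := Real.rpow_pos_of_pos (Real.exp_pos _) _
  obtain ⟨hT0, hT⟩ := lintegral_socialSurplus_geometricLaw hσ hk
    (Real.rpow_lt_rpow_of_exponent_lt hk hθ)
  set T := ∫⁻ γ, ENNReal.ofReal (socialSurplus (criticalCost hσ γ)) ∂geometricLaw hk E with hTdef
  have hchain : ENNReal.ofReal (1 - criticalBound σ θ) * T ≤ ENNReal.ofReal (1 - b) * T := by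
    calc ENNReal.ofReal (1 - criticalBound σ θ) * T
        = ∫⁻ _, ENNReal.ofReal (1 - criticalBound σ θ) * T ∂(F : Measure (Mechanism σ)) := by
          rw [lintegral_const, measure_univ, mul_one]
      _ ≤ ∫⁻ t, ∫⁻ γ, ENNReal.ofReal (socialSurplus (criticalCost hσ γ) -
            buyerSurplus (criticalCost hσ γ) t) ∂geometricLaw hk E
            ∂(F : Measure (Mechanism σ)) := lintegral_mono fun t =>
          lintegral_gap_ge_criticalBound hσ hθ hk (map_shrink_geometricLaw_le hk hE0) t
      _ = ∫⁻ γ, ∫⁻ t, ENNReal.ofReal (socialSurplus (criticalCost hσ γ) -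
            buyerSurplus (criticalCost hσ γ) t) ∂(F : Measure (Mechanism σ))
            ∂geometricLaw hk E := by
          have hm : ∀ c : CostFunction σ, Measurable fun t : Mechanism σ =>
              ENNReal.ofReal (socialSurplus c - buyerSurplus c t) := fun c =>
            (measurable_const.sub (measurable_buyerSurplus_right c)).ennreal_ofReal
          simp only [lintegral_geometricLaw]
          rw [lintegral_tsum fun i => ((hm _).const_mul _).aemeasurable]
          simp only [lintegral_const_mul' _ _ ENNReal.ofReal_ne_top]
      _ ≤ ∫⁻ γ, ENNReal.ofReal (1 - b) * ENNReal.ofReal (socialSurplus (criticalCost hσ γ))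
            ∂geometricLaw hk E := lintegral_mono fun γ => hgap _
      _ = ENNReal.ofReal (1 - b) * T := lintegral_const_mul' _ _ ENNReal.ofReal_ne_top
  have h1 : 0 < 1 - criticalBound σ θ := sub_pos.2 (hθlt.trans_le (min_le_right _ _))
  have h2 : 1 - b < 1 - criticalBound σ θ :=
    sub_lt_sub_left (hθlt.trans_le (min_le_left _ _)) 1
  exact absurd ((ENNReal.mul_le_mul_iff_left hT0 hT).1 hchain)
    (not_le.2 ((ENNReal.ofReal_lt_ofReal_iff h1).2 h2))

end Laws

theorem proposition6 (σ : ℝ) (hσ : σ ∈ Set.Ioo (0 : ℝ) 1) :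
    maxMinValue σ = ((saddleValue σ : ℝ) : EReal) ∧
    minMaxValue σ = ((saddleValue σ : ℝ) : EReal) ∧
    ∃ (F : ProbabilityMeasure (Mechanism σ)) (G : Ioi (σ / (1 - σ)) → CostDistribution σ),
      -- `F` is the law of the constant share mechanism with a random share in `(0, σ]`
      Measurable (constantShare hσ) ∧
      (F : Measure (Mechanism σ)) = (shareLaw σ).map (constantShare hσ) ∧
      -- `G θ` is the law of the critical cost function with a power-distributed parameter
      Measurable (criticalCost hσ) ∧
      (∀ θ, (G θ).measure = (powerLaw θ).map (criticalCost hσ)) ∧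
      -- `F` attains the max-min value, and nature's minimum against `F` is attained
      IsLeast (Set.range fun c : CostFunction σ => ratioAtCost F c)
        ((saddleValue σ : ℝ) : EReal) ∧
      -- `G θ` attains the min-max value in the limit `θ ↓ σ / (1 - σ)`
      Tendsto (fun θ => ⨆ t : Mechanism σ, ratioAtMechanism (G θ) t)
        (comap Subtype.val (𝓝[>] (σ / (1 - σ)))) (𝓝 ((saddleValue σ : ℝ) : EReal)) ∧
      -- together they form a saddle point with value `B̂(σ)`
      (⨅ G' : CostDistribution σ, ratio F G') = ((saddleValue σ : ℝ) : EReal) ∧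
      IsLimitSaddlePoint (comap Subtype.val (𝓝[>] (σ / (1 - σ)))) F G := by
  set F := shareMechanismLaw hσ with hF
  set G := criticalDistribution hσ with hG
  set linear : CostFunction σ := ⟨fun q => q, isCostFunction_id⟩ with hlinear
  have hlow : ∀ G', ((saddleValue σ : ℝ) : EReal) ≤ ratio F G' := saddleValue_le_ratio hσ
  have hlowc : ∀ c, ((saddleValue σ : ℝ) : EReal) ≤ ratioAtCost F c := fun c =>
    ratio_dirac F c ▸ hlow (CostDistribution.dirac c)
  have hlowt : ∀ G', ((saddleValue σ : ℝ) : EReal) ≤ ⨆ t : Mechanism σ, ratioAtMechanism G' t :=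
    fun G' => (hlow G').trans (ratio_le_iSup hσ F G')
  have hbound : Tendsto (fun θ : Ioi (σ / (1 - σ)) => ((criticalBound σ θ : ℝ) : EReal))
      (comap Subtype.val (𝓝[>] (σ / (1 - σ)))) (𝓝 ((saddleValue σ : ℝ) : EReal)) :=
    (continuous_coe_real_ereal.tendsto _).comp ((tendsto_criticalBound hσ).comp tendsto_comap)
  have hup : ∀ θ, ⨆ t : Mechanism σ, ratioAtMechanism (G θ) t ≤
      ((criticalBound σ θ : ℝ) : EReal) := fun θ =>
    iSup_le (ratioAtMechanism_le_criticalBound hσ θ)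
  have hne : (comap (Subtype.val : Ioi (σ / (1 - σ)) → ℝ) (𝓝[>] (σ / (1 - σ)))).NeBot :=
    NeBot.comap_of_range_mem inferInstance (by rw [Subtype.range_coe]; exact self_mem_nhdsWithin)
  have hinf : (⨅ G' : CostDistribution σ, ratio F G') = ((saddleValue σ : ℝ) : EReal) :=
    le_antisymm ((iInf_le _ (CostDistribution.dirac linear)).trans (ratio_linear_le hσ))
      (le_iInf hlow)
  refine ⟨?_, ?_, F, G, measurable_constantShare hσ, rfl, measurable_criticalCost hσ,
    fun _ => rfl, ⟨⟨linear, ?_⟩, ?_⟩, ?_, hinf, ?_⟩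
  · exact le_antisymm (iSup_le (iInf_ratioAtCost_le hσ)) (le_iSup_of_le F (le_iInf hlowc))
  · exact le_antisymm (ge_of_tendsto' hbound fun θ => (iInf_le _ (G θ)).trans (hup θ))
      (le_iInf hlowt)
  · exact le_antisymm ((ratio_dirac F linear).symm.trans_le (ratio_linear_le hσ)) (hlowc linear)
  · rintro _ ⟨c, rfl⟩
    exact hlowc c
  · exact tendsto_of_tendsto_of_tendsto_of_le_of_le tendsto_const_nhds hbound
      (fun θ => hlowt (G θ)) hup
  · rw [IsLimitSaddlePoint, hinf]
    exact tendsto_of_tendsto_of_tendsto_of_le_of_le tendsto_const_nhds hbound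
      (fun θ => (hlow (G θ)).trans (le_iSup (fun F' => ratio F' (G θ)) F))
      (fun θ => (iSup_le fun F' => ratio_le_iSup hσ F' (G θ)).trans (hup θ))
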